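/- **Theorem 1.2.** Let $m\ge 1$ and $N\ge 2m+1$ be integers, let $\Omega\subset\mathbb{R}^N$ be a bounded domain with $C^\infty$ boundary that is star-shaped with respect to one of its points, and let $$1\le p<\frac{N+2m}{N-2m}<q,\qquad s_0>0,\qquad C_0>0 .$$ Then there is $\underline{\lambda}>0$, depending only on $p,q,m,N,\Omega,s_0,C_0$, such that the following holds. Let $f\in C(\mathbb{R})$, put $F(s)=\int_0^s f(t)\,dt$, and assume $$(H_1)\qquad f(s)s-(q+1)F(s)\ge 0\ \text{ for all } s\in\mathbb{R},\qquad f(s)s\ge C_0|s|^{q+1}\ \text{ for all } |s|\le s_0 .$$ Then, for every real $\lambda<\underline{\lambda}$, the Dirichlet problem $$(E_{m,\lambda})\qquad (-\Delta)^m u=f(u)+\lambda|u|^{p-1}u\ \text{ in }\Omega,\qquad u=\frac{\partial u}{\partial\nu}=\dots=\frac{\partial^{m-1}u}{\partial\nu^{m-1}}=0\ \text{ on }\partial\Omega,$$ where $\nu$ is the outer unit normal to $\partial\Omega$, has no nontrivial regular solution: the only $u\in C^{2m}(\Omega)\cap C^{2m-1}(\overline{\Omega})$ satisfying it, if any, is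 $u\equiv 0$ in $\Omega$. -/

import Mathlib

open scoped ContDiff

noncomputable section

namespace Polyharmonic

/-- `ρ` is a smooth defining function of `Ω` on the open set `U`: it is `C^∞` on `U` with
nowhere vanishing gradient, and `Ω` is the part of `U` where `ρ` is negative. -/
structure IsDefiningFunctionOn {N : ℕ} (Ω U : Set (EuclideanSpace ℝ (Fin N)))
    (ρ : EuclideanSpace ℝ (Fin N) → ℝ) : Prop where
  isOpen : IsOpen U
  contDiffOn : ContDiffOn ℝ ∞ ρ U
  gradient_ne_zero : ∀ x ∈ U, gradient ρ x ≠ 0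
  mem_iff : ∀ x ∈ U, (x ∈ Ω ↔ ρ x < 0)

/-- A bounded smooth domain in `ℝ^N`: a nonempty bounded connected open set, lying locally on one
side of its `C^∞` boundary. -/
structure IsBoundedSmoothDomain {N : ℕ} (Ω : Set (EuclideanSpace ℝ (Fin N))) : Prop where
  isOpen : IsOpen Ω
  isConnected : IsConnected Ω
  isBounded : Bornology.IsBounded Ω
  smooth_boundary : ∀ x ∈ frontier Ω, ∃ U ρ, x ∈ U ∧ IsDefiningFunctionOn Ω U ρ

/-- `Ω` is star-shaped with respect to one of its points. -/
def IsStarShaped {N : ℕ} (Ω : Set (EuclideanSpace ℝ (Fin N))) : Prop :=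
  ∃ y ∈ Ω, StarConvex ℝ y Ω

/-- `ν` is the outer unit normal to `∂Ω` at `x ∈ ∂Ω`, i.e. `∇ρ(x) / |∇ρ(x)|` for a defining
function `ρ` of `Ω` near `x`. -/
def IsOuterUnitNormal {N : ℕ} (Ω : Set (EuclideanSpace ℝ (Fin N)))
    (x ν : EuclideanSpace ℝ (Fin N)) : Prop :=
  x ∈ frontier Ω ∧ ∃ U ρ, x ∈ U ∧ IsDefiningFunctionOn Ω U ρ ∧
    ν = ‖gradient ρ x‖⁻¹ • gradient ρ x

/-- The polyharmonic operator `(-Δ)^m`. -/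
def polyLaplacian {N : ℕ} (m : ℕ) (u : EuclideanSpace ℝ (Fin N) → ℝ) :
    EuclideanSpace ℝ (Fin N) → ℝ :=
  (fun v : EuclideanSpace ℝ (Fin N) → ℝ => -(Laplacian.laplacian v))^[m] u

/-- The Dirichlet boundary conditions `u = ∂u/∂ν = ⋯ = ∂^{m-1}u/∂ν^{m-1} = 0` on `∂Ω`, where
`∂^j u/∂ν^j (x)` is the `j`-th derivative of `u` at `x` (as a function on the closure of `Ω`)
evaluated at `(ν, …, ν)`. -/
def DirichletBC {N : ℕ} (m : ℕ) (Ω : Set (EuclideanSpace ℝ (Fin N)))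
    (u : EuclideanSpace ℝ (Fin N) → ℝ) : Prop :=
  ∀ x ν, IsOuterUnitNormal Ω x ν → ∀ j < m,
    iteratedFDerivWithin ℝ j u (closure Ω) x (fun _ => ν) = 0

/-- `u` is a regular (classical) solution, `u ∈ C^{2m}(Ω) ∩ C^{2m-1}(closure Ω)`, of
`(-Δ)^m u = f(u) + lam |u|^{p-1} u` in `Ω` under the Dirichlet boundary conditions. Only the values
of `u` on the closure of `Ω` matter. -/
structure IsRegularSolution {N : ℕ} (m : ℕ) (Ω : Set (EuclideanSpace ℝ (Fin N))) (p lam : ℝ)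
    (f : ℝ → ℝ) (u : EuclideanSpace ℝ (Fin N) → ℝ) : Prop where
  contDiffOn : ContDiffOn ℝ ((2 * m : ℕ) : WithTop ℕ∞) u Ω
  contDiffOn_closure : ContDiffOn ℝ ((2 * m - 1 : ℕ) : WithTop ℕ∞) u (closure Ω)
  equation : ∀ x ∈ Ω, polyLaplacian m u x = f (u x) + lam * (|u x| ^ (p - 1) * u x)
  boundary : DirichletBC m Ω u

/-- `f(s)s - (q+1)F(s) ≥ 0` for all `s`, where `F(s) = ∫_0^s f`, and `f(s)s ≥ C₀ |s|^{q+1}` for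
`|s| ≤ s₀`. -/
structure SupercriticalGrowth (q s₀ C₀ : ℝ) (f : ℝ → ℝ) : Prop where
  global : ∀ s : ℝ, 0 ≤ f s * s - (q + 1) * ∫ t in (0 : ℝ)..s, f t
  near_zero : ∀ s : ℝ, |s| ≤ s₀ → C₀ * |s| ^ (q + 1) ≤ f s * s

end Polyharmonic

end

/-!
The idea is Pohozaev's: combine the energy identity with the identity obtained by moving `u` along
dilations. For a solution `u` of `(-Δ)^m u = g(u)`, `g(s) = f(s) + λ|s|^{p-1}s`, write `U` for its
extension by zero, `G` for the primitive of `g` and `B = ∫ |D^m U|²`, the sum being over all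
multi-indices in `{1, …, N}^m` (`dirichletForm`).

*No boundary integrals are needed.* The function `U` is admissible as a test function, and so is its
dilation `U_s(x) = U(y + s(x - y))` for `s > 1`: since `Ω` is star-shaped about `y`, `U_s` vanishes
outside `Ω`. Green's formula (`integral_polyLaplacian_mul`) turns the equation into
`∫ g(U) ψ = ⟨D^m U, D^m ψ⟩` for both. Cauchy–Schwarz and the homogeneity of the form give
`∫ g(U) (U_s - U) ≤ (s^{2m-N} - 1)/2 · B`, and letting `s → 1` yields Pohozaev's inequality
`(N - 2m)/2 · B ≤ N ∫ G(U)` (`pohozaev`).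

*Green's formula* is proved by moving one derivative at a time. In the first step the derivatives of
`u` of order `2m - 1` are only `C¹` inside `Ω`, so `integral_div_mul` truncates the Lipschitz test
function near its zero set and passes to the limit; this uses Rademacher's theorem and the fact that
the derivative vanishes almost everywhere on the zero set. That the derivatives of `U` of order
less than `m` are Lipschitz across `∂Ω` requires that all of them, and not just the normal ones,
vanish on `∂Ω` (`DirichletBC.iteratedFDerivWithin_eq_zero`): if the derivatives of order `j` vanish
along `∂Ω`, those of order `j + 1` vanish whenever one argument is tangential.

*Conclusion.* The growth condition propagates to `f(s)s ≥ C₀|s|^{q+1}` for all `s`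
(`SupercriticalGrowth.le`). With `A = ∫ |U|^{p+1}` and `Φ = ∫ f(U)U` the energy identity reads
`B = Φ + λA`, and Pohozaev's inequality becomes `bΦ ≤ λaA` with `a, b > 0`, as `p` is subcritical
and `q` supercritical. Poincaré's inequality (`exists_poincare`) bounds `∫ U²` by a multiple of
`B`, and `2 ≤ p + 1 ≤ q + 1` gives `A ≤ ∫ U² + ∫ |U|^{q+1}`. Every term on the right is at most a
constant times `λA`, so `A ≤ λMA` with `M` depending only on the data; hence `λ ≥ 1/M` unless
`A = 0`.
-/

open Set Filter Topology MeasureTheory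
open scoped NNReal

noncomputable section

namespace Polyharmonic

section

variable {N : ℕ}

/-! ### Partial derivatives and the polyharmonic operator -/

/-- The partial derivative of `v` in the `i`-th coordinate direction. -/
def pd (i : Fin N) (v : EuclideanSpace ℝ (Fin N) → ℝ) : EuclideanSpace ℝ (Fin N) → ℝ :=
  fun x => fderiv ℝ v x (EuclideanSpace.single i 1)

/-- The partial derivative on `O`, extended by zero outside `O`. -/
def zpd (O : Set (EuclideanSpace ℝ (Fin N))) (i : Fin N) (v : EuclideanSpace ℝ (Fin N) → ℝ) :
    EuclideanSpace ℝ (Fin N) → ℝ :=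
  O.indicator (pd i v)

variable {O Ω : Set (EuclideanSpace ℝ (Fin N))} {v w : EuclideanSpace ℝ (Fin N) → ℝ}

lemma measurable_pd (i : Fin N) (v : EuclideanSpace ℝ (Fin N) → ℝ) : Measurable (pd i v) :=
  measurable_fderiv_apply_const ℝ v _

lemma pd_congr (hΩ : IsOpen Ω) (h : EqOn v w Ω) (i : Fin N) : EqOn (pd i v) (pd i w) Ω := by
  intro x hx
  have : v =ᶠ[𝓝 x] w := by filter_upwards [hΩ.mem_nhds hx] with y hy using h hy
  simp only [pd, this.fderiv_eq]

lemma contDiffOn_pd {n : ℕ} (hΩ : IsOpen Ω) (hv : ContDiffOn ℝ ((n + 1 : ℕ) : WithTop ℕ∞) v Ω)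
    (i : Fin N) : ContDiffOn ℝ (n : WithTop ℕ∞) (pd i v) Ω :=
  (hv.fderiv_of_isOpen hΩ (by norm_cast)).clm_apply contDiffOn_const

lemma pd_const_smul (i : Fin N) (c : ℝ) (v : EuclideanSpace ℝ (Fin N) → ℝ) :
    pd i (c • v) = c • pd i v := by
  funext x
  simp only [pd, Pi.smul_apply, fderiv_const_smul_field]
  rfl

lemma pd_neg (i : Fin N) (v : EuclideanSpace ℝ (Fin N) → ℝ) : pd i (-v) = -pd i v := by
  simpa using pd_const_smul i (-1) v

lemma pd_sum {ι : Type*} (s : Finset ι) (F : ι → EuclideanSpace ℝ (Fin N) → ℝ) (i : Fin N)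
    {x : EuclideanSpace ℝ (Fin N)} (hF : ∀ j ∈ s, DifferentiableAt ℝ (F j) x) :
    pd i (fun y => ∑ j ∈ s, F j y) x = ∑ j ∈ s, pd i (F j) x := by
  simp only [pd]
  rw [fderiv_fun_sum hF]
  simp

lemma pd_pd_apply (hΩ : IsOpen Ω) (hv : ContDiffOn ℝ 2 v Ω) (i j : Fin N)
    {x : EuclideanSpace ℝ (Fin N)} (hx : x ∈ Ω) :
    pd i (pd j v) x =
      fderiv ℝ (fderiv ℝ v) x (EuclideanSpace.single i 1) (EuclideanSpace.single j 1) := by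
  have h : DifferentiableAt ℝ (fderiv ℝ v) x :=
    ((hv.fderiv_of_isOpen hΩ (m := 1) (by norm_num)).contDiffAt
      (hΩ.mem_nhds hx)).differentiableAt one_ne_zero
  simp only [pd]
  unfold pd
  rw [fderiv_clm_apply h (differentiableAt_const _)]
  simp

lemma pd_comm (hΩ : IsOpen Ω) (hv : ContDiffOn ℝ 2 v Ω) (i j : Fin N) :
    EqOn (pd i (pd j v)) (pd j (pd i v)) Ω := by
  intro x hx
  rw [pd_pd_apply hΩ hv i j hx, pd_pd_apply hΩ hv j i hx]
  have := ((hv.contDiffAt (hΩ.mem_nhds hx)).isSymmSndFDerivAt (by simp))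
  exact this _ _

lemma laplacian_eq_sum_pd (hΩ : IsOpen Ω) (hv : ContDiffOn ℝ 2 v Ω)
    {x : EuclideanSpace ℝ (Fin N)} (hx : x ∈ Ω) :
    Laplacian.laplacian v x = ∑ i, pd i (pd i v) x := by
  rw [InnerProductSpace.laplacian_eq_iteratedFDeriv_orthonormalBasis v
    (EuclideanSpace.basisFun (Fin N) ℝ)]
  refine Finset.sum_congr rfl fun i _ => ?_
  rw [iteratedFDeriv_two_apply, pd_pd_apply hΩ hv i i hx]
  simp

lemma contDiffOn_laplacian {n : ℕ} (hΩ : IsOpen Ω)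
    (hv : ContDiffOn ℝ ((n + 2 : ℕ) : WithTop ℕ∞) v Ω) :
    ContDiffOn ℝ (n : WithTop ℕ∞) (-(Laplacian.laplacian v)) Ω := by
  have h2 : ContDiffOn ℝ 2 v Ω := hv.of_le (by norm_cast; omega)
  have : ContDiffOn ℝ (n : WithTop ℕ∞) (fun x => ∑ i, pd i (pd i v) x) Ω :=
    ContDiffOn.sum fun i _ => contDiffOn_pd hΩ (contDiffOn_pd hΩ hv i) i
  exact (this.congr fun x hx => laplacian_eq_sum_pd hΩ h2 hx).neg

lemma polyLaplacian_succ (k : ℕ) (v : EuclideanSpace ℝ (Fin N) → ℝ) :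
    polyLaplacian (k + 1) v = -(Laplacian.laplacian (polyLaplacian k v)) := by
  simp only [polyLaplacian, Function.iterate_succ_apply']

lemma contDiffOn_polyLaplacian (hΩ : IsOpen Ω) (k : ℕ) {n : ℕ}
    (hv : ContDiffOn ℝ ((n + 2 * k : ℕ) : WithTop ℕ∞) v Ω) :
    ContDiffOn ℝ (n : WithTop ℕ∞) (polyLaplacian k v) Ω := by
  induction k generalizing n with
  | zero => simpa [polyLaplacian] using hv
  | succ k ih =>
    rw [polyLaplacian_succ]
    exact contDiffOn_laplacian hΩ (ih (by convert hv using 2; ring))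

lemma polyLaplacian_congr (hΩ : IsOpen Ω) (h : EqOn v w Ω) (k : ℕ) :
    EqOn (polyLaplacian k v) (polyLaplacian k w) Ω := by
  induction k with
  | zero => simpa [polyLaplacian] using h
  | succ k ih =>
    intro x hx
    simp only [polyLaplacian_succ, Pi.neg_apply, neg_inj]
    have : polyLaplacian k v =ᶠ[𝓝 x] polyLaplacian k w := by
      filter_upwards [hΩ.mem_nhds hx] with y hy using ih hy
    exact (InnerProductSpace.laplacian_congr_nhds this).self_of_nhds

lemma pd_laplacian (hΩ : IsOpen Ω) (hv : ContDiffOn ℝ 3 v Ω) (i : Fin N) :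
    EqOn (pd i (Laplacian.laplacian v)) (Laplacian.laplacian (pd i v)) Ω := by
  intro x hx
  have h2 : ContDiffOn ℝ 2 v Ω := hv.of_le (by norm_num)
  have hp : ∀ j, ContDiffOn ℝ 2 (pd j v) Ω := fun j => contDiffOn_pd (n := 2) hΩ hv j
  have hpp : ∀ j, ContDiffOn ℝ 1 (pd j (pd j v)) Ω := fun j => contDiffOn_pd (n := 1) hΩ (hp j) j
  rw [pd_congr hΩ (fun y hy => laplacian_eq_sum_pd hΩ h2 hy) i hx,
    pd_sum _ (fun j => pd j (pd j v)) i fun j _ =>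
      ((hpp j).contDiffAt (hΩ.mem_nhds hx)).differentiableAt one_ne_zero,
    laplacian_eq_sum_pd hΩ (hp i) hx]
  refine Finset.sum_congr rfl fun j _ => ?_
  rw [pd_comm hΩ (hp j) i j hx]
  exact pd_congr hΩ (pd_comm hΩ h2 i j) j hx

lemma pd_polyLaplacian (hΩ : IsOpen Ω) (k : ℕ)
    (hv : ContDiffOn ℝ ((2 * k + 1 : ℕ) : WithTop ℕ∞) v Ω) (i : Fin N) :
    EqOn (pd i (polyLaplacian k v)) (polyLaplacian k (pd i v)) Ω := by
  induction k with
  | zero => intro x _; rfl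
  | succ k ih =>
    intro x hx
    have h3 : ContDiffOn ℝ ((3 : ℕ) : WithTop ℕ∞) (polyLaplacian k v) Ω :=
      contDiffOn_polyLaplacian hΩ k (by convert hv using 2; ring)
    have hpd := ih (hv.of_le (by norm_cast; omega))
    rw [polyLaplacian_succ, polyLaplacian_succ, pd_neg, Pi.neg_apply, Pi.neg_apply,
      pd_laplacian hΩ h3 i hx]
    have : pd i (polyLaplacian k v) =ᶠ[𝓝 x] polyLaplacian k (pd i v) := by
      filter_upwards [hΩ.mem_nhds hx] with y hy using hpd hy
    rw [(InnerProductSpace.laplacian_congr_nhds this).self_of_nhds]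

/-- `(-Δ)^{k+1} v` in divergence form: the field has components `(-Δ)^k ∂ᵢv`. -/
lemma polyLaplacian_succ_eq_div (hΩ : IsOpen Ω) (k : ℕ)
    (hv : ContDiffOn ℝ ((2 * (k + 1) : ℕ) : WithTop ℕ∞) v Ω)
    {x : EuclideanSpace ℝ (Fin N)} (hx : x ∈ Ω) :
    polyLaplacian (k + 1) v x = -∑ i, pd i (polyLaplacian k (pd i v)) x := by
  have h2 : ContDiffOn ℝ ((2 : ℕ) : WithTop ℕ∞) (polyLaplacian k v) Ω :=
    contDiffOn_polyLaplacian hΩ k (by convert hv using 2; ring)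
  rw [polyLaplacian_succ, Pi.neg_apply, laplacian_eq_sum_pd hΩ h2 hx]
  congr 1
  refine Finset.sum_congr rfl fun i _ => ?_
  exact pd_congr hΩ (pd_polyLaplacian hΩ k (hv.of_le (by norm_cast; omega)) i) i hx

/-! ### Functions with bounded derivatives -/

/-- All iterated partial derivatives of `v` of order at most `n` are bounded on `Ω`. -/
def HasBddDerivs (Ω : Set (EuclideanSpace ℝ (Fin N))) :
    ℕ → (EuclideanSpace ℝ (Fin N) → ℝ) → Prop
  | 0, v => ∃ C, ∀ x ∈ Ω, |v x| ≤ C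
  | n + 1, v => (∃ C, ∀ x ∈ Ω, |v x| ≤ C) ∧ ∀ i, HasBddDerivs Ω n (pd i v)

lemma HasBddDerivs.bdd {n : ℕ} (h : HasBddDerivs Ω n v) : ∃ C, ∀ x ∈ Ω, |v x| ≤ C := by
  cases n with
  | zero => exact h
  | succ n => exact h.1

lemma HasBddDerivs.congr (hΩ : IsOpen Ω) {n : ℕ} (h : HasBddDerivs Ω n v) (hvw : EqOn v w Ω) :
    HasBddDerivs Ω n w := by
  induction n generalizing v w with
  | zero =>
    obtain ⟨C, hC⟩ := h
    exact ⟨C, fun x hx => hvw hx ▸ hC x hx⟩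
  | succ n ih =>
    obtain ⟨⟨C, hC⟩, h2⟩ := h
    exact ⟨⟨C, fun x hx => hvw hx ▸ hC x hx⟩, fun i => ih (h2 i) (pd_congr hΩ hvw i)⟩

lemma HasBddDerivs.mono {n k : ℕ} (h : HasBddDerivs Ω n v) (hk : k ≤ n) :
    HasBddDerivs Ω k v := by
  induction k generalizing v n with
  | zero => exact h.bdd
  | succ k ih =>
    obtain ⟨n, rfl⟩ : ∃ n', n = n' + 1 := ⟨n - 1, by omega⟩
    exact ⟨h.1, fun i => ih (h.2 i) (by omega)⟩

lemma HasBddDerivs.polyLaplacian (hΩ : IsOpen Ω) (k : ℕ)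
    (hv : ContDiffOn ℝ ((2 * k : ℕ) : WithTop ℕ∞) v Ω) (h : HasBddDerivs Ω (2 * k) v) :
    ∃ C, ∀ x ∈ Ω, |polyLaplacian k v x| ≤ C := by
  induction k generalizing v with
  | zero => exact h
  | succ k ih =>
    have key : ∀ i, ∃ C, ∀ x ∈ Ω, |Polyharmonic.polyLaplacian k (pd i (pd i v)) x| ≤ C := fun i =>
      ih (contDiffOn_pd hΩ (contDiffOn_pd (n := 2 * k + 1) hΩ (hv.of_le (by norm_cast)) i) i)
        ((h.2 i).2 i)
    choose C hC using key
    refine ⟨∑ i, C i, fun x hx => ?_⟩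
    rw [polyLaplacian_succ_eq_div hΩ k hv hx, abs_neg]
    refine (Finset.abs_sum_le_sum_abs _ _).trans (Finset.sum_le_sum fun i _ => ?_)
    rw [pd_polyLaplacian hΩ k (contDiffOn_pd hΩ (hv.of_le (by norm_cast)) i) i hx]
    exact hC i x hx

/-- Each partial derivative is controlled by the full iterated derivative one order higher. -/
lemma norm_iteratedFDeriv_pd_le (hΩ : IsOpen Ω) {j : ℕ}
    (hv : ContDiffOn ℝ ((j + 1 : ℕ) : WithTop ℕ∞) v Ω) (i : Fin N)
    {x : EuclideanSpace ℝ (Fin N)} (hx : x ∈ Ω) :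
    ‖iteratedFDeriv ℝ j (pd i v) x‖ ≤ ‖iteratedFDeriv ℝ (j + 1) v x‖ := by
  have h1 : ContDiffAt ℝ (j : WithTop ℕ∞) (fderiv ℝ v) x :=
    (hv.fderiv_of_isOpen hΩ (by norm_cast)).contDiffAt (hΩ.mem_nhds hx)
  have h2 := (ContinuousLinearMap.apply ℝ ℝ
    (EuclideanSpace.single i (1 : ℝ))).norm_iteratedFDeriv_comp_left h1 le_rfl
  rw [norm_iteratedFDeriv_fderiv] at h2
  refine h2.trans ?_
  have h3 : ‖ContinuousLinearMap.apply ℝ ℝ (EuclideanSpace.single i (1 : ℝ))‖ ≤ 1 := by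
    refine ContinuousLinearMap.opNorm_le_bound _ zero_le_one fun f => ?_
    have := f.le_opNorm (EuclideanSpace.single i (1 : ℝ))
    simpa using this
  exact mul_le_of_le_one_left (norm_nonneg _) h3

lemma hasBddDerivs_of_iteratedFDeriv (hΩ : IsOpen Ω) {n : ℕ}
    (hv : ContDiffOn ℝ (n : WithTop ℕ∞) v Ω)
    (h : ∀ j ≤ n, ∃ C, ∀ x ∈ Ω, ‖iteratedFDeriv ℝ j v x‖ ≤ C) : HasBddDerivs Ω n v := by
  induction n generalizing v with
  | zero => simpa [HasBddDerivs] using h 0 le_rfl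
  | succ n ih =>
    refine ⟨by simpa using h 0 (by omega), fun i => ih (contDiffOn_pd hΩ hv i) fun j hj => ?_⟩
    obtain ⟨C, hC⟩ := h (j + 1) (by omega)
    exact ⟨C, fun x hx => (norm_iteratedFDeriv_pd_le hΩ
      (hv.of_le (by norm_cast; omega)) i hx).trans (hC x hx)⟩

/-- All iterated partial derivatives of `v` of order less than `n` tend to zero at `∂Ω`. -/
def VanishesAtBoundary (Ω : Set (EuclideanSpace ℝ (Fin N))) :
    ℕ → (EuclideanSpace ℝ (Fin N) → ℝ) → Prop
  | 0, _ => True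
  | n + 1, v => (∀ z ∈ frontier Ω, Tendsto v (𝓝[Ω] z) (𝓝 0)) ∧
      ∀ i, VanishesAtBoundary Ω n (pd i v)

lemma vanishesAtBoundary_of_iteratedFDeriv (hΩ : IsOpen Ω) {n : ℕ}
    (hv : ContDiffOn ℝ (n : WithTop ℕ∞) v Ω)
    (h : ∀ j < n, ∀ z ∈ frontier Ω, Tendsto (fun x => ‖iteratedFDeriv ℝ j v x‖) (𝓝[Ω] z) (𝓝 0)) :
    VanishesAtBoundary Ω n v := by
  induction n generalizing v with
  | zero => trivial
  | succ n ih =>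
    refine ⟨fun z hz => ?_, fun i => ih (contDiffOn_pd hΩ hv i) fun j hj z hz => ?_⟩
    · have := h 0 (by omega) z hz
      simp only [norm_iteratedFDeriv_zero] at this
      exact tendsto_zero_iff_norm_tendsto_zero.2 this
    · refine squeeze_zero' (Eventually.of_forall fun x => norm_nonneg _) ?_
        (h (j + 1) (by omega) z hz)
      filter_upwards [self_mem_nhdsWithin] with x hx
      exact norm_iteratedFDeriv_pd_le hΩ (hv.of_le (by norm_cast; omega)) i hx

end

section

variable {N : ℕ}

/-! ### Integration by parts against Lipschitz functions -/

variable {O Ω : Set (EuclideanSpace ℝ (Fin N))}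

/-- At almost every point of its zero set, a differentiable function has vanishing derivative: on
that set it is approximated, with zero error, by the zero linear map. -/
lemma ae_fderiv_eq_zero_of_eq_zero (hN : 0 < N) {h : EuclideanSpace ℝ (Fin N) → ℝ}
    {s : Set (EuclideanSpace ℝ (Fin N))} (hs : MeasurableSet s)
    (hd : ∀ x ∈ s, DifferentiableAt ℝ h x) (h0 : ∀ x ∈ s, h x = 0) :
    ∀ᵐ x, x ∈ s → fderiv ℝ h x = 0 := by
  set e : EuclideanSpace ℝ (Fin N) := EuclideanSpace.single ⟨0, hN⟩ 1 with he
  have hA : ApproximatesLinearOn (fun x => h x • e) (0 : _ →L[ℝ] EuclideanSpace ℝ (Fin N)) s 0 := by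
    intro x hx y hy
    simp [h0 x hx, h0 y hy]
  have key := hA.norm_fderiv_sub_le volume hs (fun x => (fderiv ℝ h x).smulRight e)
    (fun x hx => ((hd x hx).hasFDerivAt.smul_const e).hasFDerivWithinAt)
  rw [ae_restrict_iff' hs] at key
  filter_upwards [key] with x hx hxs
  have h1 := hx hxs
  rw [sub_zero, nonpos_iff_eq_zero, nnnorm_eq_zero] at h1
  ext w
  have h2 := congrArg (fun L => L w) h1
  have h3 : e ≠ 0 := by rw [he]; simp
  simpa [h3] using h2

lemma ae_pd_eq_zero_of_lipschitzWith {L : ℝ≥0} {h : EuclideanSpace ℝ (Fin N) → ℝ}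
    (hL : LipschitzWith L h) (i : Fin N) : ∀ᵐ x, h x = 0 → pd i h x = 0 := by
  have hms : MeasurableSet ({x | h x = 0} ∩ {x | DifferentiableAt ℝ h x}) :=
    (hL.continuous.measurable (measurableSet_singleton 0)).inter
      (measurableSet_of_differentiableAt ℝ h)
  filter_upwards [ae_fderiv_eq_zero_of_eq_zero (Fin.pos i) hms (fun x hx => hx.2)
    (fun x hx => hx.1), hL.ae_differentiableAt] with x hx hd h0
  simp [pd, hx ⟨h0, hd⟩]

lemma abs_pd_le_of_lipschitzWith {L : ℝ≥0} {h : EuclideanSpace ℝ (Fin N) → ℝ}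
    (hL : LipschitzWith L h) (i : Fin N) (x : EuclideanSpace ℝ (Fin N)) : |pd i h x| ≤ L := by
  have h1 := (fderiv ℝ h x).le_opNorm (EuclideanSpace.single i (1 : ℝ))
  have h2 := norm_fderiv_le_of_lipschitz ℝ hL (x₀ := x)
  simp only [PiLp.norm_single, norm_one, mul_one] at h1
  exact h1.trans h2

lemma integral_pd_mul_of_hasCompactSupport {L : ℝ≥0} {G ψ : EuclideanSpace ℝ (Fin N) → ℝ}
    (hG : ContDiff ℝ 1 G) (hGc : HasCompactSupport G) (hψ : LipschitzWith L ψ) (i : Fin N) :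
    ∫ x, pd i G x * ψ x = -∫ x, G x * pd i ψ x := by
  obtain ⟨D, hD⟩ := hG.lipschitzWith_of_hasCompactSupport hGc one_ne_zero
  have h := hψ.integral_lineDeriv_mul_eq hD hGc (EuclideanSpace.single i (1 : ℝ)) (μ := volume)
  have h1 : ∫ x, lineDeriv ℝ ψ x (EuclideanSpace.single i (1 : ℝ)) * G x =
      ∫ x, G x * pd i ψ x := by
    refine integral_congr_ae ?_
    filter_upwards [hψ.ae_differentiableAt] with x hx
    rw [hx.lineDeriv_eq_fderiv, mul_comm, pd]
  have h2 : ∫ x, lineDeriv ℝ G x (-EuclideanSpace.single i (1 : ℝ)) * ψ x =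
      -∫ x, pd i G x * ψ x := by
    rw [← integral_neg]
    congr 1 with x
    rw [((hG.differentiable one_ne_zero) x).lineDeriv_eq_fderiv, map_neg, pd]
    ring
  rw [h1, h2] at h
  linarith

/-- A Lipschitz function on the line that vanishes near `0` and is the identity far away. -/
lemma exists_truncation : ∃ (T : ℝ → ℝ) (K : ℝ≥0), LipschitzWith K T ∧
    (∀ s, |s| ≤ 1 → T s = 0) ∧ (∀ s, 2 ≤ |s| → T s = s) := by
  let b : ContDiffBump (0 : ℝ) := ⟨1, 2, zero_lt_one, one_lt_two⟩
  have hbc : ContDiff ℝ 1 (b : ℝ → ℝ) := b.contDiff (n := 1)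
  have h1 : ContDiff ℝ 1 (fun s : ℝ => s * b s) := contDiff_id.mul hbc
  obtain ⟨K, hK⟩ := h1.lipschitzWith_of_hasCompactSupport b.hasCompactSupport.mul_left one_ne_zero
  refine ⟨fun s => s - s * b s, 1 + K, LipschitzWith.id.sub hK, ?_, ?_⟩
  · intro s hs
    have : b s = 1 := b.one_of_mem_closedBall (by simpa [b] using hs)
    simp [this]
  · intro s hs
    have : b s = 0 := b.zero_of_le_dist (by simpa [b] using hs)
    simp [this]

/-- Integration by parts of `F ∈ C¹(Ω)` against a Lipschitz `φ` that vanishes where `|ψ| ≤ ε`, and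
is therefore supported in a compact subset of `Ω`. -/
lemma integral_pd_mul_of_support (hΩ : IsOpen Ω) (hΩb : Bornology.IsBounded Ω) {L L' : ℝ≥0}
    {F ψ φ : EuclideanSpace ℝ (Fin N) → ℝ} (hF : ContDiffOn ℝ 1 F Ω) (hψ : LipschitzWith L ψ)
    (hφ : LipschitzWith L' φ) (hψ0 : ∀ x ∉ Ω, ψ x = 0) {ε : ℝ} (hε : 0 < ε)
    (hφ0 : ∀ x, |ψ x| ≤ ε → φ x = 0) (i : Fin N) :
    (∫ x, pd i F x * φ x = -∫ x, F x * pd i φ x) ∧ Integrable (fun x => pd i F x * φ x) ∧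
      Integrable (fun x => F x * pd i φ x) := by
  have hψc := hψ.continuous.abs
  have hcl : ∀ δ : ℝ, IsClosed {x | δ ≤ |ψ x|} := fun δ => isClosed_le continuous_const hψc
  have hsub : ∀ δ : ℝ, 0 < δ → {x | δ ≤ |ψ x|} ⊆ Ω := by
    intro δ hδ x hx
    by_contra h
    have := hψ0 x h
    simp only [mem_ofPred_eq, this, abs_zero] at hx
    linarith
  -- a cutoff equal to `1` near `{ε ≤ |ψ|}` makes `F` globally `C¹` without changing the integrals
  obtain ⟨χ, hχ1, hχ0, -⟩ := exists_contMDiffMap_one_nhds_of_subset_interior (n := 1)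
    (modelWithCornersSelf ℝ (EuclideanSpace ℝ (Fin N))) (hcl ε)
    (t := {x | ε / 2 ≤ |ψ x|}) (by
      intro x hx
      have ho : IsOpen {x | ε / 2 < |ψ x|} := isOpen_lt continuous_const hψc
      refine interior_maximal (fun y (hy : ε / 2 < |ψ y|) => hy.le) ho ?_
      exact lt_of_lt_of_le (half_lt_self hε) hx)
  have hχs : ContDiff ℝ 1 (χ : EuclideanSpace ℝ (Fin N) → ℝ) := χ.contMDiff.contDiff
  have hts : tsupport (χ : EuclideanSpace ℝ (Fin N) → ℝ) ⊆ {x | ε / 2 ≤ |ψ x|} := by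
    refine closure_minimal (fun x hx => ?_) (hcl _)
    by_contra h
    exact hx (hχ0 x h)
  have hcomp : HasCompactSupport (χ : EuclideanSpace ℝ (Fin N) → ℝ) :=
    Metric.isCompact_of_isClosed_isBounded (isClosed_tsupport _)
      (hΩb.subset (hts.trans (hsub _ (by linarith))))
  set G : EuclideanSpace ℝ (Fin N) → ℝ := fun x => χ x * F x with hG
  have hGs : ContDiff ℝ 1 G := by
    rw [contDiff_iff_contDiffAt]
    intro x
    by_cases hx : x ∈ tsupport (χ : EuclideanSpace ℝ (Fin N) → ℝ)
    · exact hχs.contDiffAt.mul (hF.contDiffAt (hΩ.mem_nhds (hsub _ (by linarith) (hts hx))))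
    · have : G =ᶠ[𝓝 x] fun _ => 0 := by
        filter_upwards [(isClosed_tsupport _).isOpen_compl.mem_nhds hx] with y hy
        simp [hG, image_eq_zero_of_notMem_tsupport hy]
      exact contDiffAt_const.congr_of_eventuallyEq this
  have hGc : HasCompactSupport G := hcomp.mul_right
  have hmain := integral_pd_mul_of_hasCompactSupport hGs hGc hφ i
  have hGF : ∀ x, ε ≤ |ψ x| → G =ᶠ[𝓝 x] F := by
    intro x hx
    filter_upwards [hχ1.filter_mono (nhds_le_nhdsSet (show x ∈ {x | ε ≤ |ψ x|} from hx))] with y hy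
    simp [hG, hy]
  have e1 : (fun x => pd i F x * φ x) = fun x => pd i G x * φ x := by
    funext x
    rcases le_or_gt ε |ψ x| with h | h
    · simp only [pd, (hGF x h).fderiv_eq]
    · simp [hφ0 x h.le]
  have e2 : (fun x => F x * pd i φ x) = fun x => G x * pd i φ x := by
    funext x
    rcases le_or_gt ε |ψ x| with h | h
    · rw [(hGF x h).self_of_nhds]
    · have : φ =ᶠ[𝓝 x] fun _ => 0 := by
        filter_upwards [(isOpen_lt hψc continuous_const).mem_nhds h] with y hy
        exact hφ0 y (le_of_lt hy)
      simp [pd, this.fderiv_eq]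
  refine ⟨by rw [e1, e2]; exact hmain, ?_, ?_⟩
  · rw [e1]
    have hc : Continuous (pd i G) := (hGs.continuous_fderiv one_ne_zero).clm_apply continuous_const
    refine (hc.mul hφ.continuous).integrable_of_hasCompactSupport (HasCompactSupport.mul_right ?_)
    exact (hGc.fderiv ℝ).comp_left (g := fun f : EuclideanSpace ℝ (Fin N) →L[ℝ] ℝ =>
      f (EuclideanSpace.single i 1)) (by simp)
  · rw [e2]
    refine Integrable.mul_bdd (c := L') (hGs.continuous.integrable_of_hasCompactSupport hGc)
      (measurable_pd i φ).aestronglyMeasurable ?_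
    exact Eventually.of_forall fun x => abs_pd_le_of_lipschitzWith hφ i x

/-- The divergence theorem for a field that is `C¹` and bounded in `Ω`, with bounded divergence,
against a Lipschitz function vanishing outside `O ⊆ Ω`. No regularity up to the boundary is needed:
`ψ` is truncated near its zero set, so that only compact subsets of `Ω` matter. -/
lemma integral_div_mul (hΩ : IsOpen Ω) (hΩb : Bornology.IsBounded Ω) (hO : O ⊆ Ω) {L : ℝ≥0}
    {F : Fin N → EuclideanSpace ℝ (Fin N) → ℝ} {ψ : EuclideanSpace ℝ (Fin N) → ℝ}
    (hF : ∀ i, ContDiffOn ℝ 1 (F i) Ω) (hFb : ∀ i, ∃ C, ∀ x ∈ Ω, |F i x| ≤ C)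
    (hdiv : ∃ C, ∀ x ∈ Ω, |∑ i, pd i (F i) x| ≤ C)
    (hψ : LipschitzWith L ψ) (hψ0 : ∀ x ∉ O, ψ x = 0) :
    ∫ x, (∑ i, pd i (F i) x) * ψ x = -∑ i, ∫ x, F i x * zpd O i ψ x := by
  obtain ⟨T, K, hTL, hT0, hTid⟩ := exists_truncation
  have hψΩ : ∀ x ∉ Ω, ψ x = 0 := fun x hx => hψ0 x fun h => hx (hO h)
  have hT00 : T 0 = 0 := hT0 0 (by simp)
  set c : ℕ → ℝ := fun n => n + 1 with hc
  have hcpos : ∀ n, 0 < c n := fun n => by positivity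
  set φ : ℕ → EuclideanSpace ℝ (Fin N) → ℝ := fun n x => (c n)⁻¹ * T (c n * ψ x) with hφ
  have hφL : ∀ n, LipschitzWith (K * L) (φ n) := by
    intro n
    refine LipschitzWith.of_dist_le_mul fun x y => ?_
    have h1 := hTL.dist_le_mul (c n * ψ x) (c n * ψ y)
    have h2 := hψ.dist_le_mul x y
    simp only [Real.dist_eq, hφ, ← mul_sub, abs_mul, abs_inv, abs_of_pos (hcpos n)] at h1 h2 ⊢
    rw [inv_mul_le_iff₀ (hcpos n)]
    refine h1.trans ?_
    push_cast
    have := mul_le_mul_of_nonneg_left h2 (mul_nonneg K.2 (hcpos n).le)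
    calc (K : ℝ) * (c n * |ψ x - ψ y|) = K * c n * |ψ x - ψ y| := by ring
      _ ≤ K * c n * (L * dist x y) := this
      _ = _ := by ring
  have hφ0 : ∀ n x, |ψ x| ≤ (c n)⁻¹ → φ n x = 0 := by
    intro n x hx
    simp only [hφ]
    rw [hT0, mul_zero]
    rw [abs_mul, abs_of_pos (hcpos n)]
    calc c n * |ψ x| ≤ c n * (c n)⁻¹ := mul_le_mul_of_nonneg_left hx (hcpos n).le
      _ = 1 := mul_inv_cancel₀ (hcpos n).ne'
  have hparts := fun n i => integral_pd_mul_of_support hΩ hΩb (hF i) hψ (hφL n) hψΩ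
    (inv_pos.2 (hcpos n)) (hφ0 n) i
  have hn : ∀ n, ∫ x, (∑ i, pd i (F i) x) * φ n x = -∑ i, ∫ x, F i x * pd i (φ n) x := by
    intro n
    simp_rw [Finset.sum_mul]
    rw [integral_finsetSum _ fun i _ => (hparts n i).2.1, ← Finset.sum_neg_distrib]
    exact Finset.sum_congr rfl fun i _ => (hparts n i).1
  have hlarge : ∀ x, ψ x ≠ 0 → ∀ᶠ n in atTop, 2 < |c n * ψ x| := by
    intro x hx
    have h1 : Tendsto c atTop atTop := tendsto_atTop_add_const_right _ _ tendsto_natCast_atTop_atTop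
    filter_upwards [(h1.atTop_mul_const (abs_pos.2 hx)).eventually_gt_atTop 2] with n hn
    rwa [abs_mul, abs_of_pos (hcpos n)]
  have hfin : volume Ω ≠ ⊤ := hΩb.measure_lt_top.ne
  have hint : ∀ C : ℝ, Integrable (Ω.indicator fun _ => C) :=
    fun C => (integrable_indicator_iff hΩ.measurableSet).2 (integrableOn_const hfin)
  have hφΩ : ∀ n, ∀ x ∉ Ω, φ n x = 0 := fun n x hx => hφ0 n x (by
    rw [hψΩ x hx, abs_zero]; exact (inv_pos.2 (hcpos n)).le)
  have hpdΩ : ∀ n i, ∀ x, ψ x = 0 → pd i (φ n) x = 0 := by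
    intro n i x hx
    have : φ n =ᶠ[𝓝 x] fun _ => 0 := by
      have ho : IsOpen {x | |ψ x| < (c n)⁻¹} := isOpen_lt hψ.continuous.abs continuous_const
      filter_upwards [ho.mem_nhds (show |ψ x| < (c n)⁻¹ by
        rw [hx, abs_zero]; exact inv_pos.2 (hcpos n))] with y hy
      exact hφ0 n y (le_of_lt hy)
    simp [pd, this.fderiv_eq]
  -- the truncations converge to `ψ`, and their derivatives to those of `ψ`, almost everywhere
  have hlim : ∀ x, Tendsto (fun n => φ n x) atTop (𝓝 (ψ x)) := by
    intro x
    refine tendsto_const_nhds.congr' ?_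
    by_cases hx : ψ x = 0
    · exact Eventually.of_forall fun n => by simp [hφ, hx, hT00]
    · filter_upwards [hlarge x hx] with n hn
      simp only [hφ]
      rw [hTid _ hn.le, inv_mul_cancel_left₀ (hcpos n).ne']
  have hlim' : ∀ i, ∀ᵐ x, Tendsto (fun n => pd i (φ n) x) atTop (𝓝 (zpd O i ψ x)) := by
    intro i
    filter_upwards [ae_pd_eq_zero_of_lipschitzWith hψ i] with x hx0
    refine tendsto_const_nhds.congr' ?_
    by_cases hx : ψ x = 0
    · refine Eventually.of_forall fun n => ?_
      beta_reduce
      rw [hpdΩ n i x hx]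
      by_cases hxO : x ∈ O <;> simp [zpd, hxO, hx0 hx]
    · have hxO : x ∈ O := by_contra fun h => hx (hψ0 x h)
      filter_upwards [hlarge x hx] with n hn
      have : φ n =ᶠ[𝓝 x] ψ := by
        have ho : IsOpen {x | 2 < |c n * ψ x|} :=
          isOpen_lt continuous_const (continuous_const.mul hψ.continuous).abs
        filter_upwards [ho.mem_nhds hn] with y hy
        simp only [hφ]
        rw [hTid _ (le_of_lt hy), inv_mul_cancel_left₀ (hcpos n).ne']
      simp [zpd, hxO, pd, this.fderiv_eq]
  have hleft : Tendsto (fun n => ∫ x, (∑ i, pd i (F i) x) * φ n x) atTop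
      (𝓝 (∫ x, (∑ i, pd i (F i) x) * ψ x)) := by
    obtain ⟨C, hC⟩ := hdiv
    obtain ⟨B, hB⟩ := hΩb.isCompact_closure.exists_bound_of_continuousOn hψ.continuous.continuousOn
    have hM : ∀ x ∈ Ω, ∀ n, |φ n x| ≤ K * B := by
      intro x hx n
      have h1 := hTL.dist_le_mul (c n * ψ x) 0
      rw [hT00, Real.dist_eq, Real.dist_eq, sub_zero, sub_zero, abs_mul, abs_of_pos (hcpos n)] at h1
      simp only [hφ, abs_mul, abs_inv, abs_of_pos (hcpos n)]
      rw [inv_mul_le_iff₀ (hcpos n)]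
      refine h1.trans ?_
      have h2 := mul_le_mul_of_nonneg_left (hB x (subset_closure hx)) (mul_nonneg K.2 (hcpos n).le)
      rw [Real.norm_eq_abs] at h2
      calc (K : ℝ) * (c n * |ψ x|) = K * c n * |ψ x| := by ring
        _ ≤ K * c n * B := h2
        _ = _ := by ring
    refine tendsto_integral_of_dominated_convergence (Ω.indicator fun _ => C * (K * B))
      (fun n => ?_) (hint _) (fun n => Eventually.of_forall fun x => ?_)
      (Eventually.of_forall fun x => (hlim x).const_mul _)
    · exact ((Finset.measurable_sum _ fun i _ => measurable_pd i (F i)).mul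
        (hφL n).continuous.measurable).aestronglyMeasurable
    · by_cases hx : x ∈ Ω
      · rw [indicator_of_mem hx, Real.norm_eq_abs, abs_mul]
        exact mul_le_mul (hC x hx) (hM x hx n) (abs_nonneg _) ((abs_nonneg _).trans (hC x hx))
      · rw [indicator_of_notMem hx, hφΩ n x hx]; simp
  have hright : Tendsto (fun n => -∑ i, ∫ x, F i x * pd i (φ n) x) atTop
      (𝓝 (-∑ i, ∫ x, F i x * zpd O i ψ x)) := by
    refine (tendsto_finsetSum _ fun i _ => ?_).neg
    obtain ⟨C, hC⟩ := hFb i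
    refine tendsto_integral_of_dominated_convergence (Ω.indicator fun _ => C * (K * L : ℝ≥0))
      (fun n => (hparts n i).2.2.aestronglyMeasurable) (hint _)
      (fun n => Eventually.of_forall fun x => ?_) ?_
    · by_cases hx : x ∈ Ω
      · rw [indicator_of_mem hx, Real.norm_eq_abs, abs_mul]
        exact mul_le_mul (hC x hx) (abs_pd_le_of_lipschitzWith (hφL n) i x) (abs_nonneg _)
          ((abs_nonneg _).trans (hC x hx))
      · rw [indicator_of_notMem hx, hpdΩ n i x (hψΩ x hx)]; simp
    · filter_upwards [hlim' i] with x hx using hx.const_mul _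
  simp_rw [hn] at hleft
  exact tendsto_nhds_unique hleft hright

end

section

variable {N : ℕ}

/-! ### Zero extensions and the Dirichlet form -/

variable {O Ω O' : Set (EuclideanSpace ℝ (Fin N))} {v ψ : EuclideanSpace ℝ (Fin N) → ℝ}

/-- `ψ` vanishes outside `O` and, for the partial derivatives on `O` extended by zero, it has `k`
derivatives, those of order `< k` being Lipschitz on the whole space and those of order `k` bounded
and measurable. This is the classical counterpart of membership in `H^k_0(O)`. -/
def IsZeroExt (O : Set (EuclideanSpace ℝ (Fin N))) :
    ℕ → (EuclideanSpace ℝ (Fin N) → ℝ) → Prop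
  | 0, ψ => Measurable ψ ∧ (∃ C, ∀ x, |ψ x| ≤ C) ∧ ∀ x ∉ O, ψ x = 0
  | k + 1, ψ => (∃ L, LipschitzWith L ψ) ∧ (∀ x ∉ O, ψ x = 0) ∧ DifferentiableOn ℝ ψ O ∧
      ∀ i, IsZeroExt O k (zpd O i ψ)

/-- The Dirichlet form `∑ ∫ ∂_I v ∂_I ψ` over all multi-indices `I ∈ {1, …, N}^k`, where the
derivatives of `v` are taken on `O`, those of `ψ` on `O'`, and all are extended by zero. -/
def dirichletForm (O O' : Set (EuclideanSpace ℝ (Fin N))) :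
    ℕ → (EuclideanSpace ℝ (Fin N) → ℝ) → (EuclideanSpace ℝ (Fin N) → ℝ) → ℝ
  | 0, v, ψ => ∫ x, v x * ψ x
  | k + 1, v, ψ => ∑ i, dirichletForm O O' k (zpd O i v) (zpd O' i ψ)

lemma IsZeroExt.eq_zero {k : ℕ} (h : IsZeroExt O k ψ) : ∀ x ∉ O, ψ x = 0 := by
  cases k with
  | zero => exact h.2.2
  | succ k => exact h.2.1

lemma IsZeroExt.measurable {k : ℕ} (h : IsZeroExt O k ψ) : Measurable ψ := by
  cases k with
  | zero => exact h.1
  | succ k => exact h.1.choose_spec.continuous.measurable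

lemma IsZeroExt.bdd (hb : Bornology.IsBounded O) {k : ℕ} (h : IsZeroExt O k ψ) :
    ∃ C, ∀ x, |ψ x| ≤ C := by
  cases k with
  | zero => exact h.2.1
  | succ k =>
    obtain ⟨L, hL⟩ := h.1
    obtain ⟨C, hC⟩ := hb.isCompact_closure.exists_bound_of_continuousOn hL.continuous.continuousOn
    refine ⟨max C 0, fun x => ?_⟩
    by_cases hx : x ∈ O
    · exact (hC x (subset_closure hx)).trans (le_max_left _ _)
    · rw [h.eq_zero x hx, abs_zero]; exact le_max_right _ _

/-- A bounded measurable function vanishing outside a bounded set is integrable. -/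
lemma integrable_of_bdd_of_eq_zero (hb : Bornology.IsBounded O)
    {g : EuclideanSpace ℝ (Fin N) → ℝ} (hg : AEStronglyMeasurable g)
    (hgb : ∃ C, ∀ x, |g x| ≤ C) (h0 : ∀ x ∉ O, g x = 0) : Integrable g := by
  obtain ⟨C, hC⟩ := hgb
  have h1 : IntegrableOn g (closure O) :=
    Measure.integrableOn_of_bounded (M := C) hb.closure.measure_lt_top.ne hg
      (Eventually.of_forall hC)
  refine (integrableOn_iff_integrable_of_support_subset fun x hx => ?_).1 h1
  by_contra h
  exact hx (h0 x fun h' => h (subset_closure h'))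

lemma IsZeroExt.integrable_mul (hb : Bornology.IsBounded O) (hb' : Bornology.IsBounded O')
    {k l : ℕ} (hv : IsZeroExt O k v) (hψ : IsZeroExt O' l ψ) :
    Integrable fun x => v x * ψ x := by
  obtain ⟨C, hC⟩ := hv.bdd hb
  obtain ⟨C', hC'⟩ := hψ.bdd hb'
  refine integrable_of_bdd_of_eq_zero hb (hv.measurable.mul hψ.measurable).aestronglyMeasurable
    ⟨C * C', fun x => ?_⟩ fun x hx => by rw [hv.eq_zero x hx, zero_mul]
  rw [abs_mul]
  exact mul_le_mul (hC x) (hC' x) (abs_nonneg _) ((abs_nonneg _).trans (hC x))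

lemma dirichletForm_self_nonneg (k : ℕ) (v : EuclideanSpace ℝ (Fin N) → ℝ) :
    0 ≤ dirichletForm O O k v v := by
  induction k generalizing v with
  | zero => exact integral_nonneg fun x => mul_self_nonneg _
  | succ k ih => exact Finset.sum_nonneg fun i _ => ih _

/-- The Cauchy–Schwarz inequality, in additive form. -/
lemma dirichletForm_le (hb : Bornology.IsBounded O) (hb' : Bornology.IsBounded O') {k : ℕ}
    (hv : IsZeroExt O k v) (hψ : IsZeroExt O' k ψ) :
    dirichletForm O O' k v ψ ≤
      (dirichletForm O O k v v + dirichletForm O' O' k ψ ψ) / 2 := by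
  induction k generalizing v ψ with
  | zero =>
    simp only [dirichletForm]
    rw [← integral_add (hv.integrable_mul hb hb hv) (hψ.integrable_mul hb' hb' hψ),
      ← integral_div]
    refine integral_mono (hv.integrable_mul hb hb' hψ) (((hv.integrable_mul hb hb hv).add
      (hψ.integrable_mul hb' hb' hψ)).div_const 2) fun x => ?_
    nlinarith [sq_nonneg (v x - ψ x)]
  | succ k ih =>
    simp only [dirichletForm]
    rw [← Finset.sum_add_distrib, Finset.sum_div]
    exact Finset.sum_le_sum fun i _ => ih (hv.2.2.2 i) (hψ.2.2.2 i)

lemma zpd_const_smul (i : Fin N) (c : ℝ) (v : EuclideanSpace ℝ (Fin N) → ℝ) :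
    zpd O i (c • v) = c • zpd O i v := by
  rw [zpd, pd_const_smul, zpd]
  exact indicator_const_smul O c (pd i v)

lemma dirichletForm_smul_smul (c : ℝ) (k : ℕ) (v ψ : EuclideanSpace ℝ (Fin N) → ℝ) :
    dirichletForm O O' k (c • v) (c • ψ) = c ^ 2 * dirichletForm O O' k v ψ := by
  induction k generalizing v ψ with
  | zero =>
    simp only [dirichletForm, Pi.smul_apply, smul_eq_mul, ← integral_const_mul]
    congr 1 with x
    ring
  | succ k ih => simp only [dirichletForm, zpd_const_smul, ih, Finset.mul_sum]

/-! ### Dilations -/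

/-- The dilation `x ↦ y + s (x - y)` of ratio `s` and centre `y`. -/
def dil (y : EuclideanSpace ℝ (Fin N)) (s : ℝ) (x : EuclideanSpace ℝ (Fin N)) :
    EuclideanSpace ℝ (Fin N) :=
  y + s • (x - y)

variable {y : EuclideanSpace ℝ (Fin N)} {s : ℝ}

lemma hasFDerivAt_dil (x : EuclideanSpace ℝ (Fin N)) :
    HasFDerivAt (dil y s) (s • ContinuousLinearMap.id ℝ _) x :=
  (((hasFDerivAt_id x).sub_const y).const_smul s).const_add y

lemma lipschitzWith_dil : LipschitzWith ‖s‖₊ (dil y s) := by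
  refine LipschitzWith.of_dist_le_mul fun a b => ?_
  simp [dil, dist_eq_norm, ← smul_sub, norm_smul]

lemma zpd_comp_dil (hψ : DifferentiableOn ℝ ψ O) (hO : IsOpen O) (i : Fin N) :
    zpd (dil y s ⁻¹' O) i (ψ ∘ dil y s) = s • (zpd O i ψ ∘ dil y s) := by
  funext x
  by_cases hx : dil y s x ∈ O
  · have hd : DifferentiableAt ℝ ψ (dil y s x) := hψ.differentiableAt (hO.mem_nhds hx)
    have := (hd.hasFDerivAt.comp x (hasFDerivAt_dil x)).fderiv
    simp [zpd, hx, pd, this]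
  · simp [zpd, hx]

lemma isZeroExt_smul_comp_dil (hO : IsOpen O) (c : ℝ) {k : ℕ} (h : IsZeroExt O k ψ) :
    IsZeroExt (dil y s ⁻¹' O) k (c • (ψ ∘ dil y s)) := by
  induction k generalizing ψ c with
  | zero =>
    obtain ⟨h1, ⟨C, hC⟩, h2⟩ := h
    refine ⟨(h1.comp lipschitzWith_dil.continuous.measurable).const_smul c,
      ⟨|c| * C, fun x => ?_⟩, fun x hx => ?_⟩
    · simp only [Pi.smul_apply, smul_eq_mul, abs_mul, Function.comp]
      exact mul_le_mul_of_nonneg_left (hC _) (abs_nonneg _)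
    · simp [h2 _ hx]
  | succ k ih =>
    obtain ⟨⟨L, hL⟩, h2, h3, h4⟩ := h
    refine ⟨⟨‖c‖₊ * (L * ‖s‖₊), ?_⟩, fun x hx => by simp [h2 _ hx], ?_, fun i => ?_⟩
    · exact (lipschitzWith_smul c).comp (hL.comp lipschitzWith_dil)
    · exact (h3.comp (fun x _ => (hasFDerivAt_dil x).differentiableAt.differentiableWithinAt)
        fun x hx => hx).const_smul c
    · rw [zpd_const_smul, zpd_comp_dil h3 hO, smul_smul]
      exact ih (c * s) (h4 i)

lemma integral_comp_dil (g : EuclideanSpace ℝ (Fin N) → ℝ) (hs : 0 < s) :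
    ∫ x, g (dil y s x) = (s ^ N)⁻¹ * ∫ x, g x := by
  have h1 : ∫ x, g (dil y s x) = ∫ x, g (y + s • x) :=
    integral_sub_right_eq_self (fun x => g (y + s • x)) y
  rw [h1, Measure.integral_comp_smul volume (fun x => g (y + x)) s,
    integral_add_left_eq_self (fun x => g x) y]
  simp [abs_of_pos (pow_pos hs N)]

/-- The Dirichlet form of order `k` is homogeneous of degree `2k - N` under dilations. -/
lemma dirichletForm_comp_dil (hO : IsOpen O) (hs : 0 < s) {k : ℕ} (h : IsZeroExt O k ψ) :
    dirichletForm (dil y s ⁻¹' O) (dil y s ⁻¹' O) k (ψ ∘ dil y s) (ψ ∘ dil y s) =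
      s ^ (2 * k) * (s ^ N)⁻¹ * dirichletForm O O k ψ ψ := by
  induction k generalizing ψ with
  | zero =>
    simp only [dirichletForm, Function.comp]
    rw [integral_comp_dil (fun x => ψ x * ψ x) hs]
    simp
  | succ k ih =>
    simp only [dirichletForm]
    rw [Finset.mul_sum]
    refine Finset.sum_congr rfl fun i _ => ?_
    rw [zpd_comp_dil h.2.2.1 hO, dirichletForm_smul_smul, ih (h.2.2.2 i)]
    ring

/-! ### Poincaré inequality -/

/-- Poincaré's inequality in one direction: integrate `∂ᵢ(xᵢ) ψ² = ψ²` by parts. -/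
lemma integral_sq_le_zpd (hb : Bornology.IsBounded O) {R : ℝ}
    (hOR : ∀ x ∈ O, ‖x‖ ≤ R) {k : ℕ} (h : IsZeroExt O (k + 1) ψ) (i : Fin N) :
    ∫ x, ψ x * ψ x ≤ 4 * R ^ 2 * ∫ x, zpd O i ψ x * zpd O i ψ x := by
  obtain ⟨L, hL⟩ := h.1
  obtain ⟨C, hC⟩ := h.bdd hb
  have hC0 : 0 ≤ C := (abs_nonneg _).trans (hC 0)
  have hcomp : HasCompactSupport ψ := Metric.isCompact_of_isClosed_isBounded (isClosed_tsupport _)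
    (hb.closure.subset (closure_mono fun x hx => by
      by_contra h'
      exact hx (h.eq_zero x h')))
  have hsq : LipschitzWith (2 * C.toNNReal * L) fun x => ψ x * ψ x := by
    refine LipschitzWith.of_dist_le_mul fun a b => ?_
    have h1 := hL.dist_le_mul a b
    rw [Real.dist_eq] at h1 ⊢
    push_cast
    rw [Real.coe_toNNReal C hC0, show ψ a * ψ a - ψ b * ψ b = (ψ a + ψ b) * (ψ a - ψ b) by ring,
      abs_mul, mul_assoc]
    refine mul_le_mul ((abs_add_le _ _).trans ?_) h1 (abs_nonneg _) (by positivity)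
    linarith [hC a, hC b]
  have hcoord : LipschitzWith 1 fun x : EuclideanSpace ℝ (Fin N) => x i := by
    refine LipschitzWith.of_dist_le_mul fun a b => ?_
    rw [NNReal.coe_one, one_mul, dist_eq_norm, dist_eq_norm]
    exact PiLp.norm_apply_le (a - b) i
  have key := hcoord.integral_lineDeriv_mul_eq hsq hcomp.mul_right
    (EuclideanSpace.single i (1 : ℝ)) (μ := volume)
  have hl : ∀ x, lineDeriv ℝ (fun x : EuclideanSpace ℝ (Fin N) => x i) x
      (EuclideanSpace.single i (1 : ℝ)) = 1 := by
    intro x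
    have hd : HasFDerivAt (fun x : EuclideanSpace ℝ (Fin N) => x i)
        (EuclideanSpace.proj i : EuclideanSpace ℝ (Fin N) →L[ℝ] ℝ) x :=
      (EuclideanSpace.proj i : EuclideanSpace ℝ (Fin N) →L[ℝ] ℝ).hasFDerivAt
    rw [hd.differentiableAt.lineDeriv_eq_fderiv, hd.fderiv]
    simp
  have hr : ∫ x, lineDeriv ℝ (fun x => ψ x * ψ x) x (-EuclideanSpace.single i (1 : ℝ)) * x i =
      ∫ x, -(2 * (ψ x * zpd O i ψ x) * x i) := by
    refine integral_congr_ae ?_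
    filter_upwards [hL.ae_differentiableAt] with x hx
    have hz : ψ x * zpd O i ψ x = ψ x * pd i ψ x := by
      by_cases hxO : x ∈ O
      · simp [zpd, hxO]
      · simp [h.eq_zero x hxO]
    have hm : HasFDerivAt (fun x => ψ x * ψ x) (ψ x • fderiv ℝ ψ x + ψ x • fderiv ℝ ψ x) x :=
      hx.hasFDerivAt.mul hx.hasFDerivAt
    rw [hm.differentiableAt.lineDeriv_eq_fderiv, hm.fderiv, hz]
    simp only [pd, map_neg, add_apply, smul_apply,
      smul_eq_mul]
    ring
  simp only [hl, one_mul] at key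
  rw [hr] at key
  have i1 := h.integrable_mul hb hb h
  have i2 := (h.2.2.2 i).integrable_mul hb hb (h.2.2.2 i)
  have hle : ∫ x, -(2 * (ψ x * zpd O i ψ x) * x i) ≤
      ∫ x, (1 / 2 * (ψ x * ψ x) + 2 * R ^ 2 * (zpd O i ψ x * zpd O i ψ x)) := by
    have hpt : ∀ x, |-(2 * (ψ x * zpd O i ψ x) * x i)| ≤
        1 / 2 * (ψ x * ψ x) + 2 * R ^ 2 * (zpd O i ψ x * zpd O i ψ x) := by
      intro x
      by_cases hx : x ∈ O
      · have hxi : |x i| ≤ R := (PiLp.norm_apply_le x i).trans (hOR x hx)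
        rw [abs_neg, abs_mul, abs_mul, abs_two, abs_mul]
        have h1 := mul_le_mul_of_nonneg_left hxi
          (mul_nonneg (abs_nonneg (ψ x)) (abs_nonneg (zpd O i ψ x)))
        have h2 := sq_nonneg (|ψ x| - 2 * R * |zpd O i ψ x|)
        have h3 := abs_mul_abs_self (ψ x)
        have h4 := abs_mul_abs_self (zpd O i ψ x)
        rw [← h3, ← h4]
        nlinarith
      · rw [h.eq_zero x hx]
        simp only [zero_mul, mul_zero, neg_zero, abs_zero, zero_add]
        exact mul_nonneg (by positivity) (mul_self_nonneg _)
    have i3 := (i1.const_mul (1 / 2)).add (i2.const_mul (2 * R ^ 2))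
    refine integral_mono (i3.mono' ?_ (Eventually.of_forall hpt)) i3
      fun x => (le_abs_self _).trans (hpt x)
    exact (((h.measurable.mul (h.2.2.2 i).measurable).const_mul 2).mul
      hcoord.continuous.measurable).neg.aestronglyMeasurable
  rw [integral_add (i1.const_mul _) (i2.const_mul _), integral_const_mul, integral_const_mul] at hle
  linarith

lemma exists_poincare (hb : Bornology.IsBounded Ω) (hN : 0 < N) (k : ℕ) :
    ∃ C : ℝ, 0 < C ∧ ∀ ψ, IsZeroExt Ω k ψ →
      ∫ x, ψ x * ψ x ≤ C * dirichletForm Ω Ω k ψ ψ := by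
  induction k with
  | zero => exact ⟨1, one_pos, fun ψ _ => by simp [dirichletForm]⟩
  | succ k ih =>
    obtain ⟨C, hC, ih⟩ := ih
    obtain ⟨R, hR⟩ := hb.subset_closedBall 0
    have hOR : ∀ x ∈ Ω, ‖x‖ ≤ max R 1 := fun x hx => by
      have := hR hx
      rw [mem_closedBall_zero_iff] at this
      exact this.trans (le_max_left _ _)
    have hR0 : 0 < max R 1 := lt_of_lt_of_le one_pos (le_max_right _ _)
    refine ⟨4 * (max R 1) ^ 2 * C, by positivity, fun ψ hψ => ?_⟩
    let i : Fin N := ⟨0, hN⟩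
    calc ∫ x, ψ x * ψ x ≤ 4 * (max R 1) ^ 2 * ∫ x, zpd Ω i ψ x * zpd Ω i ψ x :=
          integral_sq_le_zpd hb hOR hψ i
      _ ≤ 4 * (max R 1) ^ 2 * (C * dirichletForm Ω Ω k (zpd Ω i ψ) (zpd Ω i ψ)) := by
          gcongr
          exact ih _ (hψ.2.2.2 i)
      _ ≤ 4 * (max R 1) ^ 2 * (C * dirichletForm Ω Ω (k + 1) ψ ψ) := by
          gcongr
          exact Finset.single_le_sum
            (f := fun j => dirichletForm Ω Ω k (zpd Ω j ψ) (zpd Ω j ψ))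
            (fun j _ => dirichletForm_self_nonneg k _) (Finset.mem_univ i)
      _ = _ := by ring

/-! ### The weak formulation -/

/-- Green's formula: `∫ (-Δ)^k v ψ` equals the Dirichlet form of `v` and `ψ`, when the derivatives
of `v` of order less than `2k` and the function `(-Δ)^k v` are bounded. -/
lemma integral_polyLaplacian_mul (hΩ : IsOpen Ω) (hb : Bornology.IsBounded Ω) (hO : O ⊆ Ω)
    (k : ℕ) (hv : ContDiffOn ℝ ((2 * k : ℕ) : WithTop ℕ∞) v Ω)
    (hbd : HasBddDerivs Ω (2 * k - 1) v) (hpoly : ∃ C, ∀ x ∈ Ω, |polyLaplacian k v x| ≤ C)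
    (hψ : IsZeroExt O k ψ) :
    ∫ x, polyLaplacian k v x * ψ x = dirichletForm Ω O k v ψ := by
  induction k generalizing v ψ with
  | zero => rfl
  | succ k ih =>
    obtain ⟨L, hL⟩ := hψ.1
    have hz : ∀ i, EqOn (pd i v) (zpd Ω i v) Ω := fun i x hx => by simp [zpd, hx]
    have hpc : ∀ i, ContDiffOn ℝ ((2 * k + 1 : ℕ) : WithTop ℕ∞) (pd i v) Ω :=
      fun i => contDiffOn_pd hΩ (hv.of_le (by norm_cast)) i
    have hpb : ∀ i, HasBddDerivs Ω (2 * k) (pd i v) := by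
      have : HasBddDerivs Ω (2 * k + 1) v := by
        rwa [show 2 * (k + 1) - 1 = 2 * k + 1 by omega] at hbd
      exact this.2
    have hF1 : ∀ i, ContDiffOn ℝ 1 (polyLaplacian k (pd i v)) Ω :=
      fun i => contDiffOn_polyLaplacian (n := 1) hΩ k ((hpc i).of_le (by norm_cast; omega))
    have hFb : ∀ i, ∃ C, ∀ x ∈ Ω, |polyLaplacian k (pd i v) x| ≤ C :=
      fun i => (hpb i).polyLaplacian hΩ k ((hpc i).of_le (by norm_cast; omega))
    have hdiv := integral_div_mul hΩ hb hO hF1 hFb (by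
      obtain ⟨C, hC⟩ := hpoly
      refine ⟨C, fun x hx => ?_⟩
      have := hC x hx
      rwa [polyLaplacian_succ_eq_div hΩ k hv hx, abs_neg] at this) hL hψ.eq_zero
    have h1 : ∫ x, polyLaplacian (k + 1) v x * ψ x =
        -∫ x, (∑ i, pd i (polyLaplacian k (pd i v)) x) * ψ x := by
      rw [← integral_neg]
      congr 1 with x
      by_cases hx : x ∈ Ω
      · rw [polyLaplacian_succ_eq_div hΩ k hv hx]; ring
      · rw [hψ.eq_zero x fun h => hx (hO h)]; simp
    rw [h1, hdiv, neg_neg, dirichletForm]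
    refine Finset.sum_congr rfl fun i _ => ?_
    have h2k : ContDiffOn ℝ ((2 * k : ℕ) : WithTop ℕ∞) (zpd Ω i v) Ω :=
      ((hpc i).of_le (by norm_cast; omega)).congr fun x hx => (hz i hx).symm
    rw [← ih h2k (((hpb i).congr hΩ (hz i)).mono (by omega))
      (((hpb i).congr hΩ (hz i)).polyLaplacian hΩ k h2k) (hψ.2.2.2 i)]
    congr 1 with x
    by_cases hx : x ∈ O
    · rw [polyLaplacian_congr hΩ (hz i) k (hO hx)]
    · rw [(hψ.2.2.2 i).eq_zero x hx, mul_zero, mul_zero]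

end

section

variable {N : ℕ}

/-! ### Symmetry of higher derivatives -/

section Symmetry

variable {E : Type*} [NormedAddCommGroup E] [NormedSpace ℝ E] {f : E → ℝ} {s : Set E}

lemma iteratedFDeriv_add_two_apply {n : ℕ} {x : E}
    (h1 : DifferentiableAt ℝ (iteratedFDeriv ℝ (n + 1) f) x)
    (h : DifferentiableAt ℝ (fderiv ℝ (iteratedFDeriv ℝ n f)) x) (m : Fin (n + 2) → E) :
    iteratedFDeriv ℝ (n + 2) f x m =
      fderiv ℝ (fderiv ℝ (iteratedFDeriv ℝ n f)) x (m 0) (m 1) (Fin.tail (Fin.tail m)) := by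
  rw [iteratedFDeriv_succ_apply_left]
  have h2 : fderiv ℝ (iteratedFDeriv ℝ (n + 1) f) x (m 0) (Fin.tail m) =
      fderiv ℝ (fun y => iteratedFDeriv ℝ (n + 1) f y (Fin.tail m)) x (m 0) :=
    (fderiv_continuousMultilinear_apply_const_apply h1 _ _).symm
  have h3 : (fun y => iteratedFDeriv ℝ (n + 1) f y (Fin.tail m)) =
      fun y => fderiv ℝ (iteratedFDeriv ℝ n f) y (m 1) (Fin.tail (Fin.tail m)) := by
    funext y
    rw [iteratedFDeriv_succ_apply_left]
    rfl
  have h4 : DifferentiableAt ℝ (fun y => fderiv ℝ (iteratedFDeriv ℝ n f) y (m 1)) x :=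
    h.clm_apply (differentiableAt_const _)
  rw [h2, h3, fderiv_continuousMultilinear_apply_const_apply h4,
    fderiv_clm_apply h (differentiableAt_const _)]
  simp

/-- The iterated derivative of a `C^{n+1}` function on an open set is invariant under adjacent
transpositions of its arguments. -/
lemma iteratedFDeriv_comp_swap (hs : IsOpen s) {n : ℕ}
    (hf : ContDiffOn ℝ ((n + 1 : ℕ) : WithTop ℕ∞) f s) (i : Fin n) {x : E} (hx : x ∈ s)
    (m : Fin (n + 1) → E) :
    iteratedFDeriv ℝ (n + 1) f x (m ∘ Equiv.swap i.castSucc i.succ) =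
      iteratedFDeriv ℝ (n + 1) f x m := by
  induction n generalizing x with
  | zero => exact i.elim0
  | succ n ih =>
    have hsm : ∀ k : ℕ, ∀ l : ℕ, l + k ≤ n + 2 →
        ContDiffAt ℝ (l : WithTop ℕ∞) (iteratedFDeriv ℝ k f) x := by
      intro k l hkl
      exact (hf.contDiffAt (hs.mem_nhds hx)).iteratedFDeriv_right (by norm_cast)
    refine Fin.cases ?_ (fun i => ?_) i
    · have h2 : ContDiffAt ℝ 2 (iteratedFDeriv ℝ n f) x := hsm n 2 (by omega)
      have hd : DifferentiableAt ℝ (fderiv ℝ (iteratedFDeriv ℝ n f)) x :=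
        (h2.fderiv_right (m := 1) (by norm_num)).differentiableAt one_ne_zero
      have hd1 : DifferentiableAt ℝ (iteratedFDeriv ℝ (n + 1) f) x :=
        (hsm (n + 1) 1 (by omega)).differentiableAt one_ne_zero
      rw [iteratedFDeriv_add_two_apply hd1 hd, iteratedFDeriv_add_two_apply hd1 hd]
      have hsymm := (h2.isSymmSndFDerivAt (by simp)).eq (m 0) (m 1)
      have e0 : (m ∘ Equiv.swap (Fin.castSucc (0 : Fin (n + 1))) (Fin.succ 0)) 0 = m 1 := by
        simp
      have e1 : (m ∘ Equiv.swap (Fin.castSucc (0 : Fin (n + 1))) (Fin.succ 0)) 1 = m 0 := by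
        simp
      have e2 : Fin.tail (Fin.tail (m ∘ Equiv.swap (Fin.castSucc (0 : Fin (n + 1)))
          (Fin.succ 0))) = Fin.tail (Fin.tail m) := by
        funext k
        simp only [Fin.tail, Function.comp]
        rw [Equiv.swap_apply_of_ne_of_ne]
        · simp [Fin.ext_iff]
        · simp [Fin.ext_iff]
      rw [e0, e1, e2, hsymm]
    · have hd : DifferentiableAt ℝ (iteratedFDeriv ℝ (n + 1) f) x :=
        (hsm (n + 1) 1 (by omega)).differentiableAt one_ne_zero
      have htail : Fin.tail (m ∘ Equiv.swap i.succ.castSucc i.succ.succ) =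
          Fin.tail m ∘ Equiv.swap i.castSucc i.succ := by
        funext k
        simp only [Fin.tail, Function.comp]
        congr 1
        rw [← Fin.succ_castSucc]
        exact ((Fin.succ_injective _).swap_apply _ _ _)
      have h0 : (m ∘ Equiv.swap i.succ.castSucc i.succ.succ) 0 = m 0 := by
        simp only [Function.comp]
        rw [Equiv.swap_apply_of_ne_of_ne]
        · simp [Fin.ext_iff]
        · simp [Fin.ext_iff]
      rw [iteratedFDeriv_succ_apply_left, iteratedFDeriv_succ_apply_left, htail, h0,
        ← fderiv_continuousMultilinear_apply_const_apply hd,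
        ← fderiv_continuousMultilinear_apply_const_apply hd]
      have hev : (fun y => iteratedFDeriv ℝ (n + 1) f y (Fin.tail m ∘ Equiv.swap i.castSucc i.succ))
          =ᶠ[𝓝 x] fun y => iteratedFDeriv ℝ (n + 1) f y (Fin.tail m) := by
        filter_upwards [hs.mem_nhds hx] with y hy
        exact ih (hf.of_le (by norm_cast; omega)) i hy _
      rw [hev.fderiv_eq]

/-- A multilinear form that is invariant under adjacent transpositions, that vanishes when its
first argument lies in the kernel of a linear form `l`, and that vanishes on the diagonal at a
vector `e` with `l e ≠ 0`, is zero. -/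
lemma multilinear_eq_zero_of_swap {n : ℕ} (A : MultilinearMap ℝ (fun _ : Fin (n + 1) => E) ℝ)
    (hswap : ∀ (i : Fin n) m, A (m ∘ Equiv.swap i.castSucc i.succ) = A m)
    (l : E →ₗ[ℝ] ℝ) (hl : ∀ m, l (m 0) = 0 → A m = 0) {e : E} (he : l e ≠ 0)
    (hdiag : A (fun _ => e) = 0) : A = 0 := by
  -- adjacent transpositions carry any argument to the first place
  have hker : ∀ (i : Fin (n + 1)) m, l (m i) = 0 → A m = 0 := by
    intro i
    induction i using Fin.induction with
    | zero => exact hl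
    | succ i ih =>
      intro m hm
      rw [← hswap i m]
      exact ih _ (by simpa using hm)
  -- so each argument may be replaced by its component along `e` modulo the kernel of `l`
  have hrep : ∀ (S : Finset (Fin (n + 1))) m,
      A m = A (fun i => if i ∈ S then (l (m i) / l e) • e else m i) := by
    intro S m
    induction S using Finset.induction_on with
    | empty => simp
    | insert a S ha ih =>
      rw [ih]
      set m' : Fin (n + 1) → E := fun i => if i ∈ S then (l (m i) / l e) • e else m i with hm'
      have e1 : m' = Function.update m' a ((m a - (l (m a) / l e) • e) + (l (m a) / l e) • e) := by
        rw [sub_add_cancel]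
        have : m a = m' a := by simp [hm', ha]
        rw [this, Function.update_eq_self]
      have e2 : (fun i => if i ∈ insert a S then (l (m i) / l e) • e else m i) =
          Function.update m' a ((l (m a) / l e) • e) := by
        funext i
        by_cases hi : i = a
        · subst hi; simp
        · simp [hm', hi]
      rw [e2]
      conv_lhs => rw [e1]
      rw [A.map_update_add, hker a, zero_add]
      simp [he]
  ext m
  rw [hrep Finset.univ m]
  simp only [Finset.mem_univ, if_true]
  rw [A.map_smul_univ (fun i => l (m i) / l e) (fun _ => e), hdiag, smul_zero,
    zero_apply]

end Symmetry

/-! ### Geometry of the boundary -/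

variable {Ω U : Set (EuclideanSpace ℝ (Fin N))} {ρ u : EuclideanSpace ℝ (Fin N) → ℝ}
  {z : EuclideanSpace ℝ (Fin N)}

lemma IsDefiningFunctionOn.hasFDerivAt (h : IsDefiningFunctionOn Ω U ρ) (hz : z ∈ U) :
    HasFDerivAt ρ (fderiv ℝ ρ z) z :=
  ((h.contDiffOn.contDiffAt (h.isOpen.mem_nhds hz)).differentiableAt (by simp)).hasFDerivAt

lemma IsDefiningFunctionOn.fderiv_gradient_pos (h : IsDefiningFunctionOn Ω U ρ) (hz : z ∈ U) :
    0 < fderiv ℝ ρ z (gradient ρ z) := by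
  have : fderiv ℝ ρ z (gradient ρ z) = ‖gradient ρ z‖ ^ 2 := by
    rw [← real_inner_self_eq_norm_sq]
    exact (InnerProductSpace.toDual_symm_apply (𝕜 := ℝ)).symm
  rw [this]
  exact pow_pos (norm_pos_iff.2 (h.gradient_ne_zero z hz)) 2

lemma IsDefiningFunctionOn.eq_zero (hΩ : IsOpen Ω) (h : IsDefiningFunctionOn Ω U ρ) (hz : z ∈ U)
    (hzf : z ∈ frontier Ω) : ρ z = 0 := by
  have hzΩ : z ∉ Ω := fun h' => by
    rw [hΩ.frontier_eq] at hzf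
    exact hzf.2 h'
  refine le_antisymm ?_ (not_lt.1 fun h' => hzΩ ((h.mem_iff z hz).2 h'))
  have hc : ContinuousAt ρ z := (h.hasFDerivAt hz).continuousAt
  by_contra! hpos
  obtain ⟨x, hx, hxU⟩ := mem_closure_iff_nhds.1 (frontier_subset_closure hzf) _
    (inter_mem (hc.eventually_const_lt hpos) (h.isOpen.mem_nhds hz))
  exact lt_asymm ((h.mem_iff x hx.2).1 hxU) hx.1

lemma IsDefiningFunctionOn.tendsto_div (hΩ : IsOpen Ω) (h : IsDefiningFunctionOn Ω U ρ)
    (hz : z ∈ U) (hzf : z ∈ frontier Ω) (d : EuclideanSpace ℝ (Fin N)) :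
    (∀ᶠ s : ℝ in 𝓝[>] 0, z + s • d ∈ U) ∧
      Tendsto (fun s : ℝ => ρ (z + s • d) / s) (𝓝[>] 0) (𝓝 (fderiv ℝ ρ z d)) := by
  have hlin : HasDerivAt (fun s : ℝ => z + s • d) d 0 := by
    simpa using ((hasDerivAt_id (0 : ℝ)).smul_const d).const_add z
  have h0 : z + (0 : ℝ) • d = z := by simp
  have hder : HasDerivAt (fun s : ℝ => ρ (z + s • d)) (fderiv ℝ ρ z d) 0 := by
    have h1 := h.hasFDerivAt hz
    rw [← h0] at h1
    have := h1.comp_hasDerivAt (0 : ℝ) hlin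
    rwa [h0] at this
  constructor
  · have hc : Tendsto (fun s : ℝ => z + s • d) (𝓝 0) (𝓝 z) := by
      simpa using hlin.continuousAt.tendsto
    exact nhdsWithin_le_nhds (hc.eventually (h.isOpen.mem_nhds hz))
  · have hslope := (hasDerivAt_iff_tendsto_slope.1 hder).mono_left
      (nhdsWithin_mono 0 fun s (hs : 0 < s) => hs.ne')
    refine hslope.congr fun s => ?_
    simp [slope_def_field, h.eq_zero hΩ hz hzf]

/-- A direction in which the defining function decreases points into the domain. -/
lemma IsDefiningFunctionOn.eventually_mem (hΩ : IsOpen Ω) (h : IsDefiningFunctionOn Ω U ρ)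
    (hz : z ∈ U) (hzf : z ∈ frontier Ω) {d : EuclideanSpace ℝ (Fin N)}
    (hd : fderiv ℝ ρ z d < 0) : ∀ᶠ s : ℝ in 𝓝[>] 0, z + s • d ∈ Ω := by
  obtain ⟨hU, hlim⟩ := h.tendsto_div hΩ hz hzf d
  filter_upwards [hlim.eventually_lt_const hd, hU, self_mem_nhdsWithin] with s hs hsU hs0
  rw [h.mem_iff _ hsU]
  by_contra! hcon
  exact absurd hs (not_lt.2 (div_nonneg hcon (le_of_lt hs0)))

/-- A direction in which the defining function increases points out of the domain. -/
lemma IsDefiningFunctionOn.eventually_notMem (hΩ : IsOpen Ω) (h : IsDefiningFunctionOn Ω U ρ)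
    (hz : z ∈ U) (hzf : z ∈ frontier Ω) {d : EuclideanSpace ℝ (Fin N)}
    (hd : 0 < fderiv ℝ ρ z d) : ∀ᶠ s : ℝ in 𝓝[>] 0, z + s • d ∉ Ω := by
  obtain ⟨hU, hlim⟩ := h.tendsto_div hΩ hz hzf d
  filter_upwards [hlim.eventually_const_lt hd, hU, self_mem_nhdsWithin] with s hs hsU hs0
  rw [h.mem_iff _ hsU]
  intro hcon
  exact absurd hs (not_lt.2 (div_nonpos_of_nonpos_of_nonneg hcon.le (le_of_lt hs0)))

/-- At a boundary point, the tangent cone contains a half-space of directions pointing into the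
domain, which spans. -/
lemma IsBoundedSmoothDomain.uniqueDiffOn_closure (hΩ : IsBoundedSmoothDomain Ω) :
    UniqueDiffOn ℝ (closure Ω) := by
  intro z hz
  rw [uniqueDiffWithinAt_closure]
  by_cases hzΩ : z ∈ Ω
  · exact hΩ.isOpen.uniqueDiffWithinAt hzΩ
  have hzf : z ∈ frontier Ω := by rw [hΩ.isOpen.frontier_eq]; exact ⟨hz, hzΩ⟩
  obtain ⟨U, ρ, hzU, h⟩ := hΩ.smooth_boundary z hzf
  refine ⟨?_, hz⟩
  have hsub : {d | fderiv ℝ ρ z d < 0} ⊆ tangentConeAt ℝ Ω z := fun d hd =>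
    mem_tangentConeAt_of_add_smul_mem (l := 𝓝[>] (0 : ℝ)) (c := id)
      (tendsto_id.mono_left (nhdsWithin_mono 0 fun s (hs : 0 < s) => hs.ne'))
      (h.eventually_mem hΩ.isOpen hzU hzf hd)
  have hopen : IsOpen {d | fderiv ℝ ρ z d < 0} :=
    isOpen_lt (fderiv ℝ ρ z).continuous continuous_const
  have htop : Submodule.span ℝ (tangentConeAt ℝ Ω z) = ⊤ := by
    refine Submodule.eq_top_of_nonempty_interior' _ ⟨-gradient ρ z, ?_⟩
    refine mem_interior.2 ⟨_, hsub.trans Submodule.subset_span, hopen, ?_⟩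
    change fderiv ℝ ρ z (-gradient ρ z) < 0
    rw [map_neg, neg_lt_zero]
    exact h.fderiv_gradient_pos hzU
  rw [htop]
  exact dense_univ

lemma exists_mem_segment_frontier (hΩ : IsOpen Ω) {a b : EuclideanSpace ℝ (Fin N)} (ha : a ∈ Ω)
    (hb : b ∉ Ω) : ∃ c ∈ segment ℝ a b, c ∈ frontier Ω := by
  by_contra! hcon
  have hsub : segment ℝ a b ⊆ Ω ∪ (closure Ω)ᶜ := by
    intro c hc
    by_cases h1 : c ∈ Ω
    · exact Or.inl h1
    · refine Or.inr fun h2 => hcon c hc ?_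
      rw [hΩ.frontier_eq]
      exact ⟨h2, h1⟩
  have := (convex_segment a b).isPreconnected.subset_left_of_subset_union hΩ
    isClosed_closure.isOpen_compl (disjoint_compl_right.mono_left subset_closure) hsub
    ⟨a, left_mem_segment ℝ a b, ha⟩
  exact hb (this (right_mem_segment ℝ a b))

/-- Vectors orthogonal to the normal are tangent to the boundary: for small `ε`, the segment from
`τ - ε∇ρ` to `τ + ε∇ρ`, scaled down and moved to `z`, crosses `∂Ω`. -/
lemma IsDefiningFunctionOn.mem_tangentConeAt_frontier (hΩ : IsOpen Ω)
    (h : IsDefiningFunctionOn Ω U ρ) (hz : z ∈ U) (hzf : z ∈ frontier Ω)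
    {τ : EuclideanSpace ℝ (Fin N)} (hτ : fderiv ℝ ρ z τ = 0) :
    τ ∈ tangentConeAt ℝ (frontier Ω) z := by
  have hpos := h.fderiv_gradient_pos hz
  have hex : ∀ n : ℕ, ∃ s : ℝ, 0 < s ∧ s < 1 / ((n : ℝ) + 1) ∧
      ∃ r : ℝ, |r| ≤ 1 / ((n : ℝ) + 1) ∧ z + s • (τ + r • gradient ρ z) ∈ frontier Ω := by
    intro n
    set ε : ℝ := 1 / ((n : ℝ) + 1) with hε
    have hε0 : 0 < ε := by positivity
    have h1 : fderiv ℝ ρ z (τ - ε • gradient ρ z) < 0 := by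
      rw [map_sub, map_smul, hτ, smul_eq_mul]; nlinarith
    have h2 : 0 < fderiv ℝ ρ z (τ + ε • gradient ρ z) := by
      rw [map_add, map_smul, hτ, smul_eq_mul]; nlinarith
    obtain ⟨s, ⟨hs1, hs2⟩, hs3, hs4⟩ := ((h.eventually_mem hΩ hz hzf h1).and
      (h.eventually_notMem hΩ hz hzf h2)).and
        (Ioo_mem_nhdsGT hε0) |>.exists
    obtain ⟨c, ⟨a, b, ha, hb, hab, rfl⟩, hc⟩ := exists_mem_segment_frontier hΩ hs1 hs2
    refine ⟨s, hs3, hs4, (b - a) * ε, ?_, ?_⟩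
    · rw [abs_mul, abs_of_pos hε0]
      refine mul_le_of_le_one_left hε0.le (abs_le.2 ⟨by linarith, by linarith⟩)
    · convert hc using 1
      have : a = 1 - b := by linarith
      subst this
      module
  choose s hs0 hs1 r hr hmem using hex
  have hlim := tendsto_one_div_add_atTop_nhds_zero_nat (𝕜 := ℝ)
  have hs : Tendsto s atTop (𝓝 0) := squeeze_zero (fun n => (hs0 n).le) (fun n => (hs1 n).le) hlim
  have hr' : Tendsto r atTop (𝓝 0) := squeeze_zero_norm hr hlim
  have hdir : Tendsto (fun n => τ + r n • gradient ρ z) atTop (𝓝 τ) := by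
    simpa using (hr'.smul_const (gradient ρ z)).const_add τ
  refine mem_tangentConeAt_of_seq atTop (fun n => (s n)⁻¹)
    (fun n => s n • (τ + r n • gradient ρ z)) ?_ (Eventually.of_forall hmem) ?_
  · simpa using hs.smul hdir
  · refine hdir.congr fun n => ?_
    rw [inv_smul_smul₀ (hs0 n).ne']

/-! ### All derivatives of order less than `m` vanish on the boundary -/

lemma iteratedFDerivWithin_closure_eq (hΩ : IsOpen Ω) (j : ℕ) {x : EuclideanSpace ℝ (Fin N)}
    (hx : x ∈ Ω) : iteratedFDerivWithin ℝ j u (closure Ω) x = iteratedFDeriv ℝ j u x := by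
  rw [← iteratedFDerivWithin_univ]
  exact iteratedFDerivWithin_congr_set
    (eventuallyEq_univ.2 (mem_of_superset (hΩ.mem_nhds hx) subset_closure)) j

lemma iteratedFDerivWithin_closure_comp_swap (hΩ : IsBoundedSmoothDomain Ω) {n : ℕ}
    (hu : ContDiffOn ℝ ((n + 1 : ℕ) : WithTop ℕ∞) u (closure Ω)) (i : Fin n)
    (hz : z ∈ closure Ω) (m : Fin (n + 1) → EuclideanSpace ℝ (Fin N)) :
    iteratedFDerivWithin ℝ (n + 1) u (closure Ω) z (m ∘ Equiv.swap i.castSucc i.succ) =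
      iteratedFDerivWithin ℝ (n + 1) u (closure Ω) z m := by
  have hc := hu.continuousOn_iteratedFDerivWithin le_rfl hΩ.uniqueDiffOn_closure
  have hcm : ∀ m, ContinuousOn
      (fun x => iteratedFDerivWithin ℝ (n + 1) u (closure Ω) x m) (closure Ω) := fun m =>
    (ContinuousMultilinearMap.apply ℝ (fun _ : Fin (n + 1) => EuclideanSpace ℝ (Fin N)) ℝ
      m).continuous.comp_continuousOn hc
  -- both sides are continuous up to the boundary, and they agree inside
  refine EqOn.of_subset_closure (s := Ω) (t := closure Ω) (fun x hx => ?_)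
    (hcm (m ∘ Equiv.swap i.castSucc i.succ)) (hcm m) subset_closure subset_rfl hz
  simp only [iteratedFDerivWithin_closure_eq hΩ.isOpen _ hx]
  exact iteratedFDeriv_comp_swap hΩ.isOpen (hu.mono subset_closure) i hx m

/-- The Dirichlet conditions prescribe only normal derivatives; the others vanish as well, because
the derivative of order `j` is zero along `∂Ω`, so its tangential derivatives vanish. -/
lemma DirichletBC.iteratedFDerivWithin_eq_zero (hΩ : IsBoundedSmoothDomain Ω) {m n : ℕ}
    (hmn : m ≤ n + 1) (hu : ContDiffOn ℝ (n : WithTop ℕ∞) u (closure Ω)) (hbc : DirichletBC m Ω u)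
    {j : ℕ} (hj : j < m) (hz : z ∈ frontier Ω) :
    iteratedFDerivWithin ℝ j u (closure Ω) z = 0 := by
  induction j generalizing z with
  | zero =>
    obtain ⟨U, ρ, hzU, h⟩ := hΩ.smooth_boundary z hz
    have h0 := hbc z _ ⟨hz, U, ρ, hzU, h, rfl⟩ 0 hj
    ext m
    rw [iteratedFDerivWithin_zero_apply] at h0 ⊢
    simpa using h0
  | succ j ih =>
    obtain ⟨U, ρ, hzU, h⟩ := hΩ.smooth_boundary z hz
    have hzc := frontier_subset_closure hz
    have hd : HasFDerivWithinAt (iteratedFDerivWithin ℝ j u (closure Ω))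
        (fderivWithin ℝ (iteratedFDerivWithin ℝ j u (closure Ω)) (closure Ω) z) (closure Ω) z :=
      (hu.differentiableOn_iteratedFDerivWithin (by norm_cast; omega)
        hΩ.uniqueDiffOn_closure z hzc).hasFDerivWithinAt
    have hd0 : HasFDerivWithinAt (iteratedFDerivWithin ℝ j u (closure Ω))
        (0 : EuclideanSpace ℝ (Fin N) →L[ℝ] _) (frontier Ω) z :=
      (hasFDerivWithinAt_const 0 z (frontier Ω)).congr (fun x hx => ih (by omega) hx)
        (ih (by omega) hz)
    have htan := (hd.mono frontier_subset_closure).unique_on hd0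
    have key := multilinear_eq_zero_of_swap
      (iteratedFDerivWithin ℝ (j + 1) u (closure Ω) z).toMultilinearMap
      (fun i m => iteratedFDerivWithin_closure_comp_swap hΩ
        (hu.of_le (by norm_cast; omega)) i hzc m)
      (fderiv ℝ ρ z).toLinearMap (fun m hm => ?_)
      (e := ‖gradient ρ z‖⁻¹ • gradient ρ z) ?_ ?_
    · ext m
      exact congrArg (fun A => A m) key
    · have := htan (h.mem_tangentConeAt_frontier hΩ.isOpen hzU hz hm)
      change iteratedFDerivWithin ℝ (j + 1) u (closure Ω) z m = 0
      rw [iteratedFDerivWithin_succ_apply_left, this]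
      rfl
    · change fderiv ℝ ρ z (‖gradient ρ z‖⁻¹ • gradient ρ z) ≠ 0
      rw [map_smul, smul_eq_mul]
      exact (mul_pos (inv_pos.2 (norm_pos_iff.2 (h.gradient_ne_zero z hzU)))
        (h.fderiv_gradient_pos hzU)).ne'
    · exact hbc z _ ⟨hz, U, ρ, hzU, h, rfl⟩ (j + 1) hj

lemma vanishesAtBoundary_of_dirichletBC (hΩ : IsBoundedSmoothDomain Ω) {m n : ℕ}
    (hmn : m ≤ n) (hu : ContDiffOn ℝ (n : WithTop ℕ∞) u (closure Ω)) (hbc : DirichletBC m Ω u) :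
    VanishesAtBoundary Ω m u := by
  refine vanishesAtBoundary_of_iteratedFDeriv hΩ.isOpen
    ((hu.mono subset_closure).of_le (by norm_cast)) fun j hj z hz => ?_
  have hc := hu.continuousOn_iteratedFDerivWithin (m := j) (by norm_cast; omega)
    hΩ.uniqueDiffOn_closure z (frontier_subset_closure hz)
  have h0 := hbc.iteratedFDerivWithin_eq_zero hΩ (by omega) hu hj hz
  have h1 := (hc.mono subset_closure).norm.tendsto
  rw [h0, norm_zero] at h1
  refine h1.congr' ?_
  filter_upwards [self_mem_nhdsWithin] with x hx
  rw [iteratedFDerivWithin_closure_eq hΩ.isOpen j hx]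

lemma hasBddDerivs_of_closure (hΩ : IsBoundedSmoothDomain Ω) {n : ℕ}
    (hu : ContDiffOn ℝ (n : WithTop ℕ∞) u (closure Ω)) : HasBddDerivs Ω n u := by
  refine hasBddDerivs_of_iteratedFDeriv hΩ.isOpen (hu.mono subset_closure) fun j hj => ?_
  obtain ⟨C, hC⟩ := hΩ.isBounded.isCompact_closure.exists_bound_of_continuousOn
    (hu.continuousOn_iteratedFDerivWithin (m := j) (by norm_cast) hΩ.uniqueDiffOn_closure)
  exact ⟨C, fun x hx => by
    rw [← iteratedFDerivWithin_closure_eq hΩ.isOpen j hx]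
    exact hC x (subset_closure hx)⟩

/-! ### Zero extensions of functions vanishing at the boundary -/

/-- A function with gradient bounded by `C` that tends to zero at `∂Ω` is bounded, at a point of
`Ω`, by `C` times the distance to any point outside `Ω`. -/
lemma abs_le_of_tendsto_frontier (hΩ : IsOpen Ω) {w : EuclideanSpace ℝ (Fin N) → ℝ}
    (hw : DifferentiableOn ℝ w Ω) {C : ℝ} (hC : ∀ x ∈ Ω, ‖fderiv ℝ w x‖ ≤ C)
    (hlim : ∀ z ∈ frontier Ω, Tendsto w (𝓝[Ω] z) (𝓝 0)) {a b : EuclideanSpace ℝ (Fin N)}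
    (ha : a ∈ Ω) (hb : b ∉ Ω) : |w a| ≤ C * dist a b := by
  have hC0 : 0 ≤ C := (norm_nonneg _).trans (hC a ha)
  set γ : ℝ → EuclideanSpace ℝ (Fin N) := fun t => a + t • (b - a) with hγ
  have hγc : Continuous γ := by fun_prop
  -- the first parameter at which the segment from `a` to `b` leaves `Ω`
  obtain ⟨t₀, ⟨ht₀I, ht₀⟩, hleast⟩ := (isCompact_Icc.inter_right
    (hΩ.isClosed_compl.preimage hγc)).exists_isLeast
      (⟨1, ⟨zero_le_one, le_rfl⟩, by simpa [hγ] using hb⟩ : (Icc (0 : ℝ) 1 ∩ γ ⁻¹' Ωᶜ).Nonempty)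
  have hin : ∀ t, 0 ≤ t → t < t₀ → γ t ∈ Ω := by
    intro t h0 ht
    by_contra h
    exact absurd (hleast ⟨⟨h0, ht.le.trans ht₀I.2⟩, h⟩) (not_le.2 ht)
  have hpos : 0 < t₀ := by
    refine lt_of_le_of_ne ht₀I.1 fun h => ht₀ ?_
    rw [← h]
    simpa [hγ] using ha
  have hlt : Iio t₀ ∩ Ici 0 ∈ 𝓝[<] t₀ :=
    inter_mem self_mem_nhdsWithin (nhdsWithin_le_nhds (Ici_mem_nhds hpos))
  have htend : Tendsto γ (𝓝[<] t₀) (𝓝[Ω] (γ t₀)) := by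
    refine tendsto_nhdsWithin_iff.2 ⟨hγc.continuousWithinAt, ?_⟩
    filter_upwards [hlt] with t ht using hin t ht.2 ht.1
  have hfr : γ t₀ ∈ frontier Ω := by
    rw [hΩ.frontier_eq]
    exact ⟨mem_closure_of_tendsto hγc.continuousWithinAt
      (by filter_upwards [hlt] with t ht using hin t ht.2 ht.1), ht₀⟩
  have hbd : ∀ᶠ t in 𝓝[<] t₀, ‖w (γ t) - w a‖ ≤ C * dist a b := by
    filter_upwards [hlt] with t ht
    have hseg : ∀ x ∈ segment ℝ a (γ t), x ∈ Ω := by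
      rintro x ⟨c, d, hc, hd, hcd, rfl⟩
      have : c • a + d • γ t = γ (d * t) := by
        have : c = 1 - d := by linarith
        subst this
        simp only [hγ]
        module
      rw [this]
      have ht0 : 0 ≤ t := ht.2
      have ht1 : t < t₀ := ht.1
      exact hin _ (mul_nonneg hd ht0) (by nlinarith)
    have h1 := (convex_segment a (γ t)).norm_image_sub_le_of_norm_fderiv_le (𝕜 := ℝ)
      (fun x hx => hw.differentiableAt (hΩ.mem_nhds (hseg x hx))) (fun x hx => hC x (hseg x hx))
      (left_mem_segment ℝ a (γ t)) (right_mem_segment ℝ a (γ t))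
    refine h1.trans (mul_le_mul_of_nonneg_left ?_ hC0)
    have ht0 : 0 ≤ t := ht.2
    have ht1 : t ≤ 1 := (le_of_lt ht.1).trans ht₀I.2
    rw [dist_comm, dist_eq_norm]
    simp only [hγ, add_sub_cancel_left, norm_smul, Real.norm_eq_abs, abs_of_nonneg ht0]
    exact mul_le_of_le_one_left (norm_nonneg _) ht1
  have h2 := le_of_tendsto ((((hlim _ hfr).comp htend).sub_const (w a)).norm) hbd
  simpa using h2

lemma exists_lipschitzWith_indicator (hΩ : IsOpen Ω) {w : EuclideanSpace ℝ (Fin N) → ℝ}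
    (hw : DifferentiableOn ℝ w Ω) {C : ℝ} (hC : ∀ x ∈ Ω, ‖fderiv ℝ w x‖ ≤ C)
    (hlim : ∀ z ∈ frontier Ω, Tendsto w (𝓝[Ω] z) (𝓝 0)) :
    ∃ L, LipschitzWith L (Ω.indicator w) := by
  have hC0 : 0 ≤ max C 0 := le_max_right _ _
  replace hC : ∀ x ∈ Ω, ‖fderiv ℝ w x‖ ≤ max C 0 := fun x hx => (hC x hx).trans (le_max_left _ _)
  generalize max C 0 = C at hC hC0
  refine ⟨C.toNNReal, LipschitzWith.of_dist_le_mul fun a b => ?_⟩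
  have hmax : C ≤ (C.toNNReal : ℝ) := Real.le_coe_toNNReal C
  rw [Real.dist_eq]
  refine le_trans ?_ (mul_le_mul_of_nonneg_right hmax dist_nonneg)
  have hout : ∀ {a b}, a ∈ Ω → b ∉ Ω → |w a| ≤ C * dist a b :=
    fun ha hb => abs_le_of_tendsto_frontier hΩ hw hC hlim ha hb
  by_cases ha : a ∈ Ω <;> by_cases hb : b ∈ Ω
  · rw [indicator_of_mem ha, indicator_of_mem hb]
    by_cases hseg : segment ℝ a b ⊆ Ω
    · have h1 := (convex_segment a b).norm_image_sub_le_of_norm_fderiv_le (𝕜 := ℝ)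
        (fun x hx => hw.differentiableAt (hΩ.mem_nhds (hseg hx))) (fun x hx => hC x (hseg hx))
        (right_mem_segment ℝ a b) (left_mem_segment ℝ a b)
      rwa [← dist_eq_norm a b] at h1
    · obtain ⟨c, hc, hcΩ⟩ := not_subset.1 hseg
      have hd := dist_add_dist_of_mem_segment hc
      calc |w a - w b| ≤ |w a| + |w b| := abs_sub _ _
        _ ≤ C * dist a c + C * dist b c := add_le_add (hout ha hcΩ) (hout hb hcΩ)
        _ = C * dist a b := by rw [← hd, dist_comm b c]; ring
  · rw [indicator_of_mem ha, indicator_of_notMem hb, sub_zero]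
    exact hout ha hb
  · rw [indicator_of_notMem ha, indicator_of_mem hb, zero_sub, abs_neg, dist_comm]
    exact hout hb ha
  · rw [indicator_of_notMem ha, indicator_of_notMem hb, sub_zero, abs_zero]
    exact mul_nonneg hC0 dist_nonneg

lemma norm_fderiv_le_sum (w : EuclideanSpace ℝ (Fin N) → ℝ) (x : EuclideanSpace ℝ (Fin N)) :
    ‖fderiv ℝ w x‖ ≤ ∑ i, |pd i w x| := by
  refine ContinuousLinearMap.opNorm_le_bound _ (Finset.sum_nonneg fun i _ => abs_nonneg _)
    fun a => ?_
  have ha : a = ∑ i, a i • EuclideanSpace.single i (1 : ℝ) := by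
    have := (EuclideanSpace.basisFun (Fin N) ℝ).sum_repr a
    simpa using this.symm
  conv_lhs => rw [ha]
  rw [map_sum, Finset.sum_mul]
  refine (norm_sum_le _ _).trans (Finset.sum_le_sum fun i _ => ?_)
  rw [map_smul, smul_eq_mul, Real.norm_eq_abs, abs_mul, mul_comm]
  exact mul_le_mul_of_nonneg_left (PiLp.norm_apply_le a i) (abs_nonneg _)

lemma isZeroExt_indicator (hΩ : IsOpen Ω) {k : ℕ} {w : EuclideanSpace ℝ (Fin N) → ℝ}
    (hw : ContDiffOn ℝ (k : WithTop ℕ∞) w Ω) (hb : HasBddDerivs Ω k w)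
    (h0 : VanishesAtBoundary Ω k w) : IsZeroExt Ω k (Ω.indicator w) := by
  induction k generalizing w with
  | zero =>
    refine ⟨?_, ?_, fun x hx => indicator_of_notMem hx _⟩
    · have : ContinuousOn w Ω := hw.continuousOn
      classical
      rw [← piecewise_eq_indicator]
      exact this.measurable_piecewise continuousOn_const hΩ.measurableSet
    · obtain ⟨C, hC⟩ := hb
      refine ⟨max C 0, fun x => ?_⟩
      by_cases hx : x ∈ Ω
      · rw [indicator_of_mem hx]; exact (hC x hx).trans (le_max_left _ _)
      · rw [indicator_of_notMem hx, abs_zero]; exact le_max_right _ _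
  | succ k ih =>
    have hd : DifferentiableOn ℝ w Ω := hw.differentiableOn (by norm_cast)
    have hz : ∀ i, zpd Ω i (Ω.indicator w) = Ω.indicator (pd i w) := by
      intro i
      funext x
      by_cases hx : x ∈ Ω
      · have heq : EqOn (Ω.indicator w) w Ω := fun y hy => indicator_of_mem hy _
        simp [zpd, hx, pd_congr hΩ heq i hx]
      · simp [zpd, hx]
    refine ⟨?_, fun x hx => indicator_of_notMem hx _, ?_, fun i => ?_⟩
    · choose C hC using fun i => (hb.2 i).bdd
      exact exists_lipschitzWith_indicator hΩ hd (C := ∑ i, C i) (fun x hx =>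
        (norm_fderiv_le_sum w x).trans (Finset.sum_le_sum fun i _ => hC i x hx)) h0.1
    · exact hd.congr fun x hx => indicator_of_mem hx _
    · rw [hz]
      exact ih (contDiffOn_pd hΩ hw i) (hb.2 i) (h0.2 i)

end

section

variable {N : ℕ}

/-! ### Growth of the nonlinearity -/

section Growth

variable {q s₀ C₀ : ℝ} {f : ℝ → ℝ}

/-- The lower bound on `f(s)s` propagates from `[0, s₀]` to `[0, ∞)`, since `F(s) / s^{q+1}` is
nondecreasing. -/
lemma SupercriticalGrowth.le_of_nonneg (h : SupercriticalGrowth q s₀ C₀ f) (hf : Continuous f)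
    (hq : 0 < q) (hs₀ : 0 < s₀) {s : ℝ} (hs : 0 ≤ s) : C₀ * s ^ (q + 1) ≤ f s * s := by
  rcases le_or_gt s s₀ with hle | hlt
  · simpa [abs_of_nonneg hs] using h.near_zero s (by rwa [abs_of_nonneg hs])
  set F : ℝ → ℝ := fun s => ∫ t in (0 : ℝ)..s, f t with hF
  have hFd : ∀ x, HasDerivAt F (f x) x := fun x =>
    intervalIntegral.integral_hasDerivAt_right (hf.intervalIntegrable _ _)
      hf.stronglyMeasurable.stronglyMeasurableAtFilter hf.continuousAt
  have hFc : Continuous F := continuous_iff_continuousAt.2 fun x => (hFd x).continuousAt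
  have h1 : C₀ / (q + 1) * s₀ ^ (q + 1) ≤ F s₀ := by
    have hmono : MonotoneOn (fun x => F x - C₀ / (q + 1) * x ^ (q + 1)) (Icc 0 s₀) := by
      have hd : ∀ x ∈ interior (Icc 0 s₀), HasDerivAt
          (fun x => F x - C₀ / (q + 1) * x ^ (q + 1)) (f x - C₀ * x ^ q) x := by
        intro x hx
        rw [interior_Icc] at hx
        have := (hFd x).sub ((Real.hasDerivAt_rpow_const (p := q + 1)
          (Or.inl hx.1.ne')).const_mul (C₀ / (q + 1)))
        refine this.congr_deriv ?_
        rw [add_sub_cancel_right]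
        field_simp
      refine monotoneOn_of_deriv_nonneg (convex_Icc _ _) ?_ ?_ ?_
      · refine (hFc.sub (continuous_const.mul ?_)).continuousOn
        exact Real.continuous_rpow_const (by linarith)
      · exact fun x hx => (hd x hx).differentiableAt.differentiableWithinAt
      · intro x hx
        rw [(hd x hx).deriv]
        rw [interior_Icc] at hx
        have h2 := h.near_zero x (by rw [abs_of_pos hx.1]; exact hx.2.le)
        rw [abs_of_pos hx.1, Real.rpow_add_one hx.1.ne', ← mul_assoc] at h2
        linarith [le_of_mul_le_mul_right h2 hx.1]
    have := hmono (left_mem_Icc.2 hs₀.le) (right_mem_Icc.2 hs₀.le) hs₀.le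
    simp only [hF, intervalIntegral.integral_same, Real.zero_rpow (by linarith : q + 1 ≠ 0),
      mul_zero, sub_zero] at this
    linarith
  have h2 : F s₀ * s₀ ^ (-(q + 1)) ≤ F s * s ^ (-(q + 1)) := by
    have hpos : ∀ x ∈ Ici s₀, 0 < x := fun x hx => lt_of_lt_of_le hs₀ hx
    have hd : ∀ x ∈ Ici s₀, HasDerivAt (fun x => F x * x ^ (-(q + 1)))
        (f x * x ^ (-(q + 1)) + F x * (-(q + 1) * x ^ (-(q + 1) - 1))) x := fun x hx =>
      (hFd x).mul (Real.hasDerivAt_rpow_const (Or.inl (hpos x hx).ne'))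
    have hmono : MonotoneOn (fun x => F x * x ^ (-(q + 1))) (Ici s₀) := by
      refine monotoneOn_of_deriv_nonneg (convex_Ici _) ?_ ?_ ?_
      · exact fun x hx => (hd x hx).continuousAt.continuousWithinAt
      · exact fun x hx => (hd x (interior_subset hx)).differentiableAt.differentiableWithinAt
      · intro x hx
        rw [(hd x (interior_subset hx)).deriv]
        have hx0 := hpos x (interior_subset hx)
        have e : x ^ (-(q + 1)) = x ^ (-(q + 1) - 1) * x := by
          rw [← Real.rpow_add_one hx0.ne', sub_add_cancel]
        have h3 := mul_nonneg (Real.rpow_pos_of_pos hx0 (-(q + 1) - 1)).le (h.global x)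
        change 0 ≤ _ * (f x * x - (q + 1) * F x) at h3
        rw [e]
        linarith
    exact hmono self_mem_Ici hlt.le hlt.le
  have hspos : 0 < s := hs₀.trans hlt
  have h3 : C₀ / (q + 1) ≤ F s * s ^ (-(q + 1)) := by
    refine le_trans ?_ h2
    rw [Real.rpow_neg hs₀.le, ← div_eq_mul_inv, le_div_iff₀ (Real.rpow_pos_of_pos hs₀ _)]
    exact h1
  rw [Real.rpow_neg hspos.le, ← div_eq_mul_inv, le_div_iff₀ (Real.rpow_pos_of_pos hspos _),
    div_mul_eq_mul_div, div_le_iff₀ (by linarith)] at h3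
  have h4 := h.global s
  change 0 ≤ f s * s - (q + 1) * F s at h4
  linarith

lemma SupercriticalGrowth.neg (h : SupercriticalGrowth q s₀ C₀ f) :
    SupercriticalGrowth q s₀ C₀ fun s => -f (-s) := by
  constructor
  · intro s
    have := h.global (-s)
    rw [intervalIntegral.integral_neg, intervalIntegral.integral_comp_neg, neg_zero,
      intervalIntegral.integral_symm, neg_neg]
    linarith
  · intro s hs
    have := h.near_zero (-s) (by rwa [abs_neg])
    rw [abs_neg] at this
    linarith

lemma SupercriticalGrowth.le (h : SupercriticalGrowth q s₀ C₀ f) (hf : Continuous f)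
    (hq : 0 < q) (hs₀ : 0 < s₀) (s : ℝ) : C₀ * |s| ^ (q + 1) ≤ f s * s := by
  rcases le_total 0 s with hs | hs
  · rw [abs_of_nonneg hs]
    exact h.le_of_nonneg hf hq hs₀ hs
  · rw [abs_of_nonpos hs]
    have := h.neg.le_of_nonneg (hf.comp continuous_neg).neg hq hs₀ (neg_nonneg.2 hs)
    rw [neg_neg] at this
    linarith

end Growth

/-! ### The Pohozaev inequality -/

variable {Ω : Set (EuclideanSpace ℝ (Fin N))} {y : EuclideanSpace ℝ (Fin N)}

lemma preimage_dil_subset (hstar : StarConvex ℝ y Ω) {s : ℝ} (hs : 1 ≤ s) :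
    dil y s ⁻¹' Ω ⊆ Ω := by
  intro x hx
  have hs0 : 0 < s := by linarith
  have h1 := hstar (show dil y s x ∈ Ω from hx) (sub_nonneg.2 (inv_le_one_of_one_le₀ hs))
    (inv_pos.2 hs0).le (sub_add_cancel _ _)
  convert h1 using 1
  simp only [dil, smul_add, smul_smul, inv_mul_cancel₀ hs0.ne']
  module

lemma abs_dil_sub_le {L : ℝ≥0} {U : EuclideanSpace ℝ (Fin N) → ℝ} (hU : LipschitzWith L U)
    {s : ℝ} (hs : 1 ≤ s) (x : EuclideanSpace ℝ (Fin N)) :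
    |U (dil y s x) - U x| ≤ L * ‖x - y‖ * (s - 1) := by
  have h1 := hU.dist_le_mul (dil y s x) x
  rw [Real.dist_eq, dist_eq_norm] at h1
  have h2 : dil y s x - x = (s - 1) • (x - y) := by simp only [dil]; module
  rw [h2, norm_smul, Real.norm_eq_abs, abs_of_nonneg (sub_nonneg.2 hs)] at h1
  linarith

lemma integrable_comp_mul (hb : Bornology.IsBounded Ω) {k l : ℕ}
    {O : Set (EuclideanSpace ℝ (Fin N))} (hO : O ⊆ Ω) {U ψ : EuclideanSpace ℝ (Fin N) → ℝ}
    (hU : IsZeroExt Ω k U) (hψ : IsZeroExt O l ψ) {g : ℝ → ℝ} (hg : Continuous g) :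
    Integrable fun x => g (U x) * ψ x := by
  obtain ⟨C, hC⟩ := hU.bdd hb
  obtain ⟨C', hC'⟩ := hψ.bdd (hb.subset hO)
  obtain ⟨D, hD⟩ := (isCompact_Icc (a := -C) (b := C)).exists_bound_of_continuousOn
    hg.continuousOn
  refine integrable_of_bdd_of_eq_zero (hb.subset hO)
    ((hg.measurable.comp hU.measurable).mul hψ.measurable).aestronglyMeasurable
    ⟨D * C', fun x => ?_⟩ fun x hx => by rw [hψ.eq_zero x hx, mul_zero]
  have h1 := hD (U x) (abs_le.1 (hC x))
  rw [abs_mul]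
  exact mul_le_mul h1 (hC' x) (abs_nonneg _) ((norm_nonneg _).trans h1)

lemma integrable_comp (hb : Bornology.IsBounded Ω) {k : ℕ} {U : EuclideanSpace ℝ (Fin N) → ℝ}
    (hU : IsZeroExt Ω k U) {g : ℝ → ℝ} (hg : Continuous g) (hg0 : g 0 = 0) :
    Integrable fun x => g (U x) := by
  obtain ⟨C, hC⟩ := hU.bdd hb
  obtain ⟨D, hD⟩ := (isCompact_Icc (a := -C) (b := C)).exists_bound_of_continuousOn
    hg.continuousOn
  exact integrable_of_bdd_of_eq_zero hb (hg.measurable.comp hU.measurable).aestronglyMeasurable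
    ⟨D, fun x => hD (U x) (abs_le.1 (hC x))⟩ fun x hx => by rw [hU.eq_zero x hx, hg0]

/-- First-order Taylor expansion of a primitive of `g`, uniform on bounded sets. -/
lemma exists_primitive_sub_le {g : ℝ → ℝ} (hg : Continuous g) (C : ℝ) {η : ℝ} (hη : 0 < η) :
    ∃ δ > 0, ∀ a b, |a| ≤ C → |b| ≤ C → |b - a| < δ →
      |(∫ t in (0 : ℝ)..b, g t) - (∫ t in (0 : ℝ)..a, g t) - g a * (b - a)| ≤ η * |b - a| := by
  have huc := isCompact_Icc (a := -C) (b := C) |>.uniformContinuousOn_of_continuous hg.continuousOn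
  obtain ⟨δ, hδ, h⟩ := Metric.uniformContinuousOn_iff.1 huc η hη
  refine ⟨δ, hδ, fun a b ha hb hab => ?_⟩
  have hi : ∀ x y, IntervalIntegrable g volume x y := fun x y => hg.intervalIntegrable x y
  rw [intervalIntegral.integral_interval_sub_left (hi _ _) (hi _ _)]
  have e : (∫ t in a..b, g t) - g a * (b - a) = ∫ t in a..b, (g t - g a) := by
    rw [intervalIntegral.integral_sub (hi _ _) intervalIntegrable_const]
    simp [mul_comm]
  rw [e, ← Real.norm_eq_abs, ← Real.norm_eq_abs]
  refine intervalIntegral.norm_integral_le_of_norm_le_const fun t ht => ?_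
  have ht' : t ∈ uIcc a b := uIoc_subset_uIcc ht
  have htC : t ∈ Icc (-C) C :=
    (uIcc_subset_Icc (abs_le.1 ha) (abs_le.1 hb)) ht'
  have hd : dist t a < δ := by
    rw [Real.dist_eq]
    exact (abs_sub_left_of_mem_uIcc ht').trans_lt hab
  exact (h t htC a (abs_le.1 ha) hd).le

/-- Pohozaev's inequality on a star-shaped domain, without boundary integrals. Test the weak
equation with `U_s - U`, where `U_s(x) = U(y + s(x - y))`, `s > 1`, is an admissible test function
because its support shrinks towards the centre `y`. By Cauchy–Schwarz and homogeneity,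
`∫ g(U) (U_s - U) ≤ (s^{2m-N} - 1)/2 · ∫ |D^m U|²`, while the left side equals
`(s^{-N} - 1) ∫ G(U) + o(s - 1)`. Comparing derivatives at `s = 1` gives the claim. -/
lemma pohozaev (hΩ : IsOpen Ω) (hb : Bornology.IsBounded Ω) (hstar : StarConvex ℝ y Ω) {m : ℕ}
    (hm : 1 ≤ m) {g : ℝ → ℝ} (hg : Continuous g) {U : EuclideanSpace ℝ (Fin N) → ℝ}
    (hU : IsZeroExt Ω m U)
    (hweak : ∀ O ⊆ Ω, ∀ ψ, IsZeroExt O m ψ → ∫ x, g (U x) * ψ x = dirichletForm Ω O m U ψ) :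
    ((N : ℝ) - 2 * m) / 2 * dirichletForm Ω Ω m U U ≤
      N * ∫ x, ∫ t in (0 : ℝ)..U x, g t := by
  set B := dirichletForm Ω Ω m U U with hB
  set G : ℝ → ℝ := fun s => ∫ t in (0 : ℝ)..s, g t with hG
  have hGc : Continuous G := intervalIntegral.continuous_primitive
    (fun _ _ => hg.intervalIntegrable _ _) 0
  have hG0 : G 0 = 0 := intervalIntegral.integral_same
  set I := ∫ x, G (U x) with hI
  obtain ⟨L, hL⟩ : ∃ L, LipschitzWith L U := by
    obtain ⟨k, rfl⟩ : ∃ k, m = k + 1 := ⟨m - 1, by omega⟩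
    exact hU.1
  obtain ⟨C, hC⟩ := hU.bdd hb
  obtain ⟨R, hR0, hR⟩ : ∃ R : ℝ, 0 < R ∧ ∀ x ∈ Ω, ‖x - y‖ ≤ R := by
    obtain ⟨R, hR⟩ := hb.subset_closedBall y
    refine ⟨max R 1, lt_of_lt_of_le one_pos (le_max_right _ _), fun x hx => ?_⟩
    have := hR hx
    rw [Metric.mem_closedBall, dist_eq_norm] at this
    exact this.trans (le_max_left _ _)
  set K : ℝ := L * R * volume.real Ω with hK
  -- the integrated comparison between `U` and its dilations
  have hcomp : ∀ η : ℝ, 0 < η → ∀ᶠ s : ℝ in 𝓝[>] 1,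
      ((s ^ N)⁻¹ - 1) * I ≤ (s ^ (2 * m) * (s ^ N)⁻¹ - 1) / 2 * B + η * K * (s - 1) := by
    intro η hη
    obtain ⟨δ, hδ, hδG⟩ := exists_primitive_sub_le hg C hη
    have hev : ∀ᶠ s : ℝ in 𝓝[>] 1, L * R * (s - 1) < δ := by
      have : Tendsto (fun s : ℝ => L * R * (s - 1)) (𝓝[>] 1) (𝓝 (L * R * (1 - 1))) :=
        ((continuous_const.mul (continuous_id.sub continuous_const)).tendsto 1).mono_left
          nhdsWithin_le_nhds
      exact this.eventually_lt_const (by simpa using hδ)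
    filter_upwards [hev, self_mem_nhdsWithin] with s hsδ hs1
    have hs1' : 1 ≤ s := le_of_lt hs1
    have hs0 : 0 < s := by linarith
    have hsub := preimage_dil_subset hstar hs1'
    have hUs : IsZeroExt (dil y s ⁻¹' Ω) m (U ∘ dil y s) := by
      simpa using isZeroExt_smul_comp_dil (y := y) (s := s) hΩ 1 hU
    have hi1 : Integrable fun x => g (U x) * (U ∘ dil y s) x :=
      integrable_comp_mul hb hsub hU hUs hg
    have hi2 : Integrable fun x => g (U x) * U x :=
      integrable_comp_mul hb subset_rfl hU hU hg
    have hi3 : Integrable fun x => G (U x) := integrable_comp hb hU hGc hG0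
    have hi4 : Integrable fun x => G (U (dil y s x)) :=
      integrable_comp (hb.subset hsub) hUs hGc hG0
    have hform : (∫ x, g (U x) * (U ∘ dil y s) x) - ∫ x, g (U x) * U x ≤
        (s ^ (2 * m) * (s ^ N)⁻¹ - 1) / 2 * B := by
      rw [hweak _ hsub _ hUs, hweak Ω subset_rfl U hU, ← hB]
      have h1 := dirichletForm_le hb (hb.subset hsub) hU hUs
      rw [dirichletForm_comp_dil hΩ hs0 hU, ← hB] at h1
      linarith
    have hpt : ∀ x, G (U (dil y s x)) - G (U x) -
        (g (U x) * (U ∘ dil y s) x - g (U x) * U x) ≤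
        Ω.indicator (fun _ => η * (L * R * (s - 1))) x := by
      intro x
      by_cases hx : x ∈ Ω
      · rw [indicator_of_mem hx]
        have hd : |U (dil y s x) - U x| ≤ L * R * (s - 1) := by
          refine (abs_dil_sub_le hL hs1' x).trans ?_
          have := hR x hx
          have h3 : 0 ≤ s - 1 := by linarith
          gcongr
        have h2 := (le_abs_self _).trans (hδG (U x) (U (dil y s x)) (hC _) (hC _)
          (hd.trans_lt hsδ))
        simp only [Function.comp]
        rw [← mul_sub]
        exact h2.trans (mul_le_mul_of_nonneg_left hd hη.le)
      · rw [indicator_of_notMem hx]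
        have h1 : U (dil y s x) = 0 := hU.eq_zero _ fun h => hx (hsub h)
        simp [h1, hU.eq_zero x hx]
    have hint : ∫ x, (G (U (dil y s x)) - G (U x) -
        (g (U x) * (U ∘ dil y s) x - g (U x) * U x)) ≤
        ∫ x, Ω.indicator (fun _ => η * (L * R * (s - 1))) x :=
      integral_mono ((hi4.sub hi3).sub (hi1.sub hi2))
      ((integrable_indicator_iff hΩ.measurableSet).2 (integrableOn_const hb.measure_lt_top.ne)) hpt
    have e1 : ∫ x, Ω.indicator (fun _ => η * (L * R * (s - 1))) x = η * K * (s - 1) := by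
      rw [integral_indicator hΩ.measurableSet, setIntegral_const, smul_eq_mul, hK]
      ring
    have e2 : ∫ x, G (U (dil y s x)) = (s ^ N)⁻¹ * I :=
      integral_comp_dil (fun x => G (U x)) hs0
    rw [e1, integral_sub (f := fun x => G (U (dil y s x)) - G (U x))
      (g := fun x => g (U x) * (U ∘ dil y s) x - g (U x) * U x) (hi4.sub hi3) (hi1.sub hi2),
      integral_sub hi4 hi3,
      integral_sub hi1 hi2, e2] at hint
    linarith
  have hderiv : ∀ η : ℝ, 0 < η → 0 ≤ (2 * m - N : ℝ) / 2 * B + η * K + N * I := by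
    intro η hη
    set φ : ℝ → ℝ := fun s =>
      (s ^ (2 * m) * (s ^ N)⁻¹ - 1) / 2 * B + η * K * (s - 1) - ((s ^ N)⁻¹ - 1) * I with hφ
    have hd : HasDerivAt φ ((2 * m - N : ℝ) / 2 * B + η * K + N * I) 1 := by
      have h1 := hasDerivAt_pow (2 * m) (1 : ℝ)
      have h2 := (hasDerivAt_pow N (1 : ℝ)).inv (by simp)
      have h3 := ((((h1.mul h2).sub_const 1).div_const 2).mul_const B).add
        (((hasDerivAt_id (1 : ℝ)).sub_const 1).const_mul (η * K))
      have h4 := h3.sub ((h2.sub_const 1).mul_const I)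
      refine h4.congr_deriv ?_
      simp only [Pi.inv_apply, one_pow, inv_one, mul_one, one_mul, div_one, Nat.cast_mul,
        Nat.cast_ofNat]
      ring
    have hφ1 : φ 1 = 0 := by simp [hφ]
    have hle : 𝓝[>] (1 : ℝ) ≤ 𝓝[≠] 1 := nhdsWithin_mono 1 fun s hs => ne_of_gt hs
    refine ge_of_tendsto ((hasDerivAt_iff_tendsto_slope.1 hd).mono_left hle) ?_
    filter_upwards [hcomp η hη, self_mem_nhdsWithin] with s hs hs1
    rw [slope_def_field, hφ1, sub_zero]
    refine div_nonneg ?_ (sub_nonneg.2 (le_of_lt hs1))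
    simp only [hφ]
    linarith
  have hlim : Tendsto (fun η : ℝ => (2 * m - N : ℝ) / 2 * B + η * K + N * I) (𝓝[>] 0)
      (𝓝 ((2 * m - N : ℝ) / 2 * B + 0 * K + N * I)) :=
    (Continuous.tendsto (by fun_prop) 0).mono_left nhdsWithin_le_nhds
  have h0 := ge_of_tendsto hlim (by
    filter_upwards [self_mem_nhdsWithin] with η hη using hderiv η hη)
  linarith

end

section

variable {N : ℕ} {Ω : Set (EuclideanSpace ℝ (Fin N))}

/-! ### Regular solutions -/

section PowerTerm

variable {p : ℝ}

lemma continuous_abs_rpow_mul (hp : 1 ≤ p) : Continuous fun s : ℝ => |s| ^ (p - 1) * s :=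
  (continuous_abs.rpow_const fun _ => Or.inr (by linarith)).mul continuous_id

lemma abs_rpow_mul_mul (hp : 1 ≤ p) (s : ℝ) : |s| ^ (p - 1) * s * s = |s| ^ (p + 1) := by
  have h1 : (0 : ℝ) ≤ p - 1 := by linarith
  rw [show p + 1 = (p - 1) + (2 : ℕ) by push_cast; ring,
    Real.rpow_add_natCast' (abs_nonneg s) (by push_cast; linarith), sq_abs]
  ring

lemma integral_abs_rpow_mul (hp : 1 ≤ p) (s : ℝ) :
    ∫ t in (0 : ℝ)..s, |t| ^ (p - 1) * t = |s| ^ (p + 1) / (p + 1) := by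
  have hd : ∀ x ∈ uIcc 0 s, HasDerivAt (fun x : ℝ => |x| ^ (p + 1) / (p + 1))
      (|x| ^ (p - 1) * x) x := by
    intro x _
    refine ((hasDerivAt_abs_rpow x (p := p + 1) (by linarith)).div_const (p + 1)).congr_deriv ?_
    rw [show p + 1 - 2 = p - 1 by ring]
    have : p + 1 ≠ 0 := by linarith
    field_simp
  rw [intervalIntegral.integral_eq_sub_of_hasDerivAt hd
    ((continuous_abs_rpow_mul hp).intervalIntegrable _ _)]
  simp [Real.zero_rpow (by linarith : p + 1 ≠ 0)]

end PowerTerm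

section Solution

variable {m : ℕ} {p lam : ℝ} {f : ℝ → ℝ} {u : EuclideanSpace ℝ (Fin N) → ℝ}

lemma IsRegularSolution.isZeroExt (hΩ : IsBoundedSmoothDomain Ω) (hm : 1 ≤ m)
    (h : IsRegularSolution m Ω p lam f u) : IsZeroExt Ω m (Ω.indicator u) :=
  isZeroExt_indicator hΩ.isOpen (h.contDiffOn.of_le (by norm_cast; omega))
    ((hasBddDerivs_of_closure hΩ h.contDiffOn_closure).mono (by omega))
    (vanishesAtBoundary_of_dirichletBC hΩ (by omega) h.contDiffOn_closure h.boundary)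

/-- A regular solution, extended by zero, solves the equation weakly, against every zero extension
from an arbitrary subset of `Ω`. -/
lemma IsRegularSolution.integral_mul_eq (hΩ : IsBoundedSmoothDomain Ω) (hm : 1 ≤ m)
    (hp : 1 ≤ p) (hf : Continuous f) (h : IsRegularSolution m Ω p lam f u)
    {O : Set (EuclideanSpace ℝ (Fin N))} (hO : O ⊆ Ω) {ψ : EuclideanSpace ℝ (Fin N) → ℝ}
    (hψ : IsZeroExt O m ψ) :
    ∫ x, (f (Ω.indicator u x) + lam * (|Ω.indicator u x| ^ (p - 1) * Ω.indicator u x)) * ψ x =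
      dirichletForm Ω O m (Ω.indicator u) ψ := by
  have heq : EqOn u (Ω.indicator u) Ω := fun x hx => (indicator_of_mem hx u).symm
  have hg : Continuous fun s => f s + lam * (|s| ^ (p - 1) * s) :=
    hf.add ((continuous_abs_rpow_mul hp).const_mul lam)
  have hpoly : ∀ x ∈ Ω, polyLaplacian m (Ω.indicator u) x =
      f (Ω.indicator u x) + lam * (|Ω.indicator u x| ^ (p - 1) * Ω.indicator u x) := by
    intro x hx
    rw [← polyLaplacian_congr hΩ.isOpen heq m hx, h.equation x hx, heq hx]
  obtain ⟨C, hC⟩ := (h.isZeroExt hΩ hm).bdd hΩ.isBounded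
  obtain ⟨D, hD⟩ := (isCompact_Icc (a := -C) (b := C)).exists_bound_of_continuousOn
    hg.continuousOn
  rw [← integral_polyLaplacian_mul hΩ.isOpen hΩ.isBounded hO m
    (h.contDiffOn.congr fun x hx => (heq hx).symm)
    ((hasBddDerivs_of_closure hΩ h.contDiffOn_closure).congr hΩ.isOpen heq)
    ⟨D, fun x hx => by rw [hpoly x hx]; exact hD _ (abs_le.1 (hC x))⟩ hψ]
  congr 1 with x
  by_cases hx : x ∈ O
  · rw [hpoly x (hO hx)]
  · rw [hψ.eq_zero x hx, mul_zero, mul_zero]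

end Solution

end

end Polyharmonic

end

open Polyharmonic

theorem theorem1p2 (N m : ℕ) (hm : 1 ≤ m) (hN : 2 * m + 1 ≤ N)
    (Ω : Set (EuclideanSpace ℝ (Fin N)))
    (hΩ : Polyharmonic.IsBoundedSmoothDomain Ω) (hstar : Polyharmonic.IsStarShaped Ω)
    (p : ℝ) (hp1 : 1 ≤ p) (hp : p < ((N : ℝ) + 2 * m) / ((N : ℝ) - 2 * m))
    (q : ℝ) (hq : ((N : ℝ) + 2 * m) / ((N : ℝ) - 2 * m) < q)
    (s₀ : ℝ) (hs₀ : 0 < s₀) (C₀ : ℝ) (hC₀ : 0 < C₀) :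
    ∃ lam₀ : ℝ, 0 < lam₀ ∧
      ∀ f : ℝ → ℝ, Continuous f → Polyharmonic.SupercriticalGrowth q s₀ C₀ f →
        ∀ lam : ℝ, lam < lam₀ →
          ¬ ∃ u : EuclideanSpace ℝ (Fin N) → ℝ,
            Polyharmonic.IsRegularSolution m Ω p lam f u ∧ ∃ x ∈ Ω, u x ≠ 0 := by
  obtain ⟨y, -, hy⟩ := hstar
  have hd : 0 < (N : ℝ) - 2 * m := by
    have : ((2 * m + 1 : ℕ) : ℝ) ≤ N := by exact_mod_cast hN
    push_cast at this
    linarith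
  have hpq : p < q := hp.trans hq
  rw [lt_div_iff₀ hd] at hp
  rw [div_lt_iff₀ hd] at hq
  obtain ⟨P, hP, hpoin⟩ := exists_poincare hΩ.isBounded (by omega : 0 < N) m
  -- `a > 0` because `p` is subcritical, `b > 0` because `q` is supercritical
  set a : ℝ := N / (p + 1) - (N - 2 * m) / 2 with ha_def
  set b : ℝ := (N - 2 * m) / 2 - N / (q + 1) with hb_def
  have ha : 0 < a := by
    rw [ha_def, sub_pos, lt_div_iff₀ (by linarith)]
    linarith
  have hb : 0 < b := by
    rw [hb_def, sub_pos, div_lt_iff₀ (by linarith)]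
    linarith
  set M : ℝ := P * (a / b + 1) + a / b / C₀ with hM_def
  have hM : 0 < M := by positivity
  refine ⟨1 / M, by positivity, ?_⟩
  rintro f hf hgrowth lam hlam ⟨u, hu, x₀, hx₀, hux₀⟩
  set U := Ω.indicator u with hU_def
  have hU : IsZeroExt Ω m U := hu.isZeroExt hΩ hm
  have hbd := hΩ.isBounded
  have hUc : Continuous U := by
    obtain ⟨k, rfl⟩ : ∃ k, m = k + 1 := ⟨m - 1, by omega⟩
    exact hU.1.choose_spec.continuous
  have hpow : Continuous fun s : ℝ => |s| ^ (p + 1) :=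
    continuous_abs.rpow_const fun _ => Or.inr (by linarith)
  have hpow' : Continuous fun s : ℝ => |s| ^ (q + 1) :=
    continuous_abs.rpow_const fun _ => Or.inr (by linarith)
  have hFc : Continuous fun s : ℝ => ∫ t in (0 : ℝ)..s, f t :=
    intervalIntegral.continuous_primitive (fun _ _ => hf.intervalIntegrable _ _) 0
  have iA : Integrable fun x => |U x| ^ (p + 1) := integrable_comp hbd hU hpow (by
    rw [abs_zero, Real.zero_rpow (by linarith)])
  have iQ : Integrable fun x => |U x| ^ (q + 1) := integrable_comp hbd hU hpow' (by
    rw [abs_zero, Real.zero_rpow (by linarith)])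
  have iF : Integrable fun x => ∫ t in (0 : ℝ)..U x, f t :=
    integrable_comp hbd hU hFc intervalIntegral.integral_same
  have iΦ : Integrable fun x => f (U x) * U x := integrable_comp_mul hbd subset_rfl hU hU hf
  have iS : Integrable fun x => U x * U x := hU.integrable_mul hbd hbd hU
  set A := ∫ x, |U x| ^ (p + 1) with hA_def
  set Φ := ∫ x, f (U x) * U x with hΦ_def
  have hApos : 0 < A := by
    refine (hpow.comp hUc).integral_pos_of_hasCompactSupport_nonneg_nonzero (x := x₀) ?_
      (fun x => Real.rpow_nonneg (abs_nonneg _) _) ?_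
    · refine Metric.isCompact_of_isClosed_isBounded (isClosed_tsupport _)
        (hbd.closure.subset (closure_mono fun x hx => ?_))
      by_contra h'
      refine hx ?_
      beta_reduce
      rw [hU.eq_zero x h', abs_zero, Real.zero_rpow (by linarith)]
    · have : U x₀ = u x₀ := Set.indicator_of_mem hx₀ u
      simp only [this]
      exact (Real.rpow_pos_of_pos (abs_pos.2 hux₀) _).ne'
  -- the energy identity: test with `U` itself
  have hB : dirichletForm Ω Ω m U U = Φ + lam * A := by
    rw [← hu.integral_mul_eq hΩ hm hp1 hf subset_rfl hU, hΦ_def, hA_def, ← integral_const_mul,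
      ← integral_add iΦ (iA.const_mul lam)]
    congr 1 with x
    rw [← abs_rpow_mul_mul hp1 (U x)]
    ring
  have hpoh := pohozaev (g := fun s => f s + lam * (|s| ^ (p - 1) * s)) hΩ.isOpen hbd hy hm
    (hf.add ((continuous_abs_rpow_mul hp1).const_mul lam)) hU
    fun O hO ψ hψ => hu.integral_mul_eq hΩ hm hp1 hf hO hψ
  have hprim : ∫ x, ∫ t in (0 : ℝ)..U x, (f t + lam * (|t| ^ (p - 1) * t)) =
      (∫ x, ∫ t in (0 : ℝ)..U x, f t) + lam * (A / (p + 1)) := by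
    rw [hA_def, ← integral_div, ← integral_const_mul,
      ← integral_add iF ((iA.div_const (p + 1)).const_mul lam)]
    congr 1 with x
    rw [intervalIntegral.integral_add (hf.intervalIntegrable _ _)
      (((continuous_abs_rpow_mul hp1).const_mul lam).intervalIntegrable _ _),
      intervalIntegral.integral_const_mul, integral_abs_rpow_mul hp1]
  rw [hprim, hB] at hpoh
  have hF : (q + 1) * ∫ x, ∫ t in (0 : ℝ)..U x, f t ≤ Φ := by
    rw [← integral_const_mul]
    exact integral_mono (iF.const_mul _) iΦ fun x => by linarith [hgrowth.global (U x)]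
  have hQ : C₀ * ∫ x, |U x| ^ (q + 1) ≤ Φ := by
    rw [← integral_const_mul]
    exact integral_mono (iQ.const_mul _) iΦ fun x =>
      hgrowth.le hf (by linarith) hs₀ (U x)
  have hAle : A ≤ (∫ x, U x * U x) + ∫ x, |U x| ^ (q + 1) := by
    rw [← integral_add iS iQ]
    refine integral_mono iA (iS.add iQ) fun x => ?_
    have h2 : U x * U x = |U x| ^ (2 : ℝ) := by
      rw [Real.rpow_two, sq_abs, sq]
    change |U x| ^ (p + 1) ≤ U x * U x + |U x| ^ (q + 1)
    rw [h2]
    -- since `2 ≤ p + 1 ≤ q + 1`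
    have hn := Real.rpow_nonneg (abs_nonneg (U x))
    rcases le_total |U x| 1 with h1 | h1
    · rcases (abs_nonneg (U x)).eq_or_lt with h0 | h0
      · rw [← h0, Real.zero_rpow (by linarith)]
        exact add_nonneg (Real.rpow_nonneg le_rfl _) (Real.rpow_nonneg le_rfl _)
      · have := Real.rpow_le_rpow_of_exponent_ge h0 h1 (show (2 : ℝ) ≤ p + 1 by linarith)
        linarith [hn (q + 1)]
    · have := Real.rpow_le_rpow_of_exponent_le h1 (show p + 1 ≤ q + 1 by linarith)
      linarith [hn 2]
  have hS := hpoin U hU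
  rw [hB] at hS
  -- Pohozaev's inequality with the growth condition: `b Φ ≤ λ a A`
  have hkey : b * Φ ≤ lam * a * A := by
    have hF' : (N : ℝ) * ∫ x, ∫ t in (0 : ℝ)..U x, f t ≤ N / (q + 1) * Φ := by
      have hq1 : 0 < q + 1 := by linarith
      rw [div_mul_eq_mul_div, le_div_iff₀ hq1]
      have := mul_le_mul_of_nonneg_left hF (Nat.cast_nonneg (α := ℝ) N)
      linarith
    have e : (N : ℝ) * (lam * (A / (p + 1))) = lam * (N / (p + 1)) * A := by ring
    rw [mul_add (N : ℝ), e] at hpoh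
    rw [ha_def, hb_def]
    linarith
  have hΦ : Φ ≤ lam * (a / b) * A := by
    rw [show lam * (a / b) * A = lam * a * A / b by ring, le_div_iff₀ hb]
    linarith
  have hQ' : ∫ x, |U x| ^ (q + 1) ≤ lam * (a / b / C₀) * A := by
    rw [show lam * (a / b / C₀) * A = lam * (a / b) * A / C₀ by ring, le_div_iff₀ hC₀]
    linarith
  have hS' : ∫ x, U x * U x ≤ lam * (P * (a / b + 1)) * A := by
    have := mul_le_mul_of_nonneg_left hΦ hP.le
    linarith
  have hfin : A ≤ lam * M * A := by
    rw [hM_def]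
    linarith
  rw [lt_div_iff₀ hM] at hlam
  nlinarith
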